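/- Let $R$ be a commutative ring with $1$, $q\in R$ invertible, $n\ge 0$, and let $\mathcal H=\mathcal H_{R,q}(\mathfrak S_n)$ be the unital associative $R$-algebra with generators $T_1,\dots,T_{n-1}$ and relations $T_iT_j=T_jT_i$ ($|i-j|>1$), $T_iT_{i+1}T_i=T_{i+1}T_iT_{i+1}$ and $(T_i+1)(T_i-q)=0$. Let $\mathfrak S_n$ act on $\{1,\dots,n\}$ from the right, let $\ell(w)$ be the least $k$ such that $w$ is a product $(i_1,i_1+1)\cdots(i_k,i_k+1)$, and for such an expression with $k=\ell(w)$ put $T_w=T_{i_1}\cdots T_{i_k}$. Let $*$ be the $R$-linear anti-automorphism of $\mathcal H$ with $T_i^*=T_i$ for all $i$. For a partition $\nu=(\nu_1\ge\dots\ge\nu_l>0)$ of $n$ let $\mathfrak t^\nu$ be the $\nu$-tableau with $1,\dots,n$ entered in order along its rows, from top to bottom; let $\mathfrak S_\nu$ be the row stabilizer of $\mathfrak t^\nu$, let $m_\nu=\sum_{w\in\mathfrak S_\nu}T_w$, and let $M^\nu=m_\nu\mathcal H$. For a standard $\nu$-tableau $\mathfrak t$ (each of $1,\dots,n$ entered once,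 increasing along rows and down columns) let $d(\mathfrak t)\in\mathfrak S_n$ be the permutation with $\mathfrak t=\mathfrak t^\nu d(\mathfrak t)$, and for standard $\nu$-tableaux $\mathfrak s,\mathfrak t$ put $m_{\mathfrak s\mathfrak t}=T_{d(\mathfrak s)}^*m_\nu T_{d(\mathfrak t)}$. Write $\nu\rhd\mu$ if $\nu\neq\mu$ and $\sum_{i\le j}\nu_i\ge\sum_{i\le j}\mu_i$ for all $j$ (missing parts being $0$). Let $\mathcal H^{\rhd\mu}$ be the $R$-span of all $m_{\mathfrak s\mathfrak t}$ with $\mathfrak s,\mathfrak t$ standard $\nu$-tableaux for some partition $\nu$ of $n$ with $\nu\rhd\mu$. For $m\ge 0$ and a sequence $\eta=(\eta_1,\dots,\eta_l)$ of non-negative integers with $m+\eta_1+\dots+\eta_l\le n$, let $\mathcal D_{m,\eta}$ be the set of minimal length right coset representatives, in the symmetric group on $\{m+1,\dots,m+\eta_1+\dots+\eta_l\}$, of the subgroup preserving each of the consecutive blocks of sizes $\eta_1,\dots,\eta_l$ of this set, and put $C(m;\eta)=\sum_{w\in\mathcal D_{m,\eta}}T_w$. Theorem. Let $\mu=(\mu_1\ge\dots\ge\mu_b>0)$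 be a partition of $n$. For $1\le d<b$ and $1\le t\le\mu_{d+1}$ put $h_{d,t}=C(\mu_1+\dots+\mu_{d-1};\mu_d,t)$. Let $\mathcal I$ be the right ideal of $\mathcal H$ generated by $\{m_\mu h_{d,t} : 1\le d<b,\ 1\le t\le\mu_{d+1}\}$. Then $$\mathcal I=M^\mu\cap\mathcal H^{\rhd\mu}.$$ -/

import Mathlib

namespace HeckeTypeA

universe u

/-! ### The symmetric group, acting on the right

Letters `1, …, n` are the elements `0, …, n - 1` of `Fin n`, and `i : Fin (n - 1)` stands for the
simple transposition exchanging the letters `i` and `i + 1` of `Fin n`.  Permutations act on the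
right: the product "first `v`, then `w`" is `w * v` in `Equiv.Perm`. -/

/-- The simple transposition `(i, i + 1)`. -/
def simple {n : ℕ} (i : Fin (n - 1)) : Equiv.Perm (Fin n) :=
  Equiv.swap ⟨i.1, by omega⟩ ⟨i.1 + 1, by omega⟩

/-- The product of simple transpositions along a word, for the right action: the first letter of the
word acts first. -/
def wordPerm {n : ℕ} (l : List (Fin (n - 1))) : Equiv.Perm (Fin n) :=
  (l.map simple).reverse.prod

theorem exists_word {n : ℕ} (w : Equiv.Perm (Fin n)) :
    ∃ k, ∃ l : List (Fin (n - 1)), l.length = k ∧ wordPerm l = w := by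
  suffices h : ∃ l : List (Fin (n - 1)), wordPerm l = w by
    obtain ⟨l, hl⟩ := h
    exact ⟨_, l, rfl, hl⟩
  cases n with
  | zero => exact ⟨[], Subsingleton.elim _ _⟩
  | succ m =>
    have hw : w ∈ Submonoid.closure
        (Set.range fun i : Fin m ↦ Equiv.swap i.castSucc i.succ) := by
      rw [Equiv.Perm.mclosure_swap_castSucc_succ]
      trivial
    induction hw using Submonoid.closure_induction with
    | mem x hx =>
      obtain ⟨i, rfl⟩ := hx
      exact ⟨[i], by simp [wordPerm]; rfl⟩
    | one => exact ⟨[], rfl⟩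
    | mul x y _ _ hx hy =>
      obtain ⟨a, rfl⟩ := hx
      obtain ⟨b, rfl⟩ := hy
      exact ⟨b ++ a, by simp [wordPerm]⟩

open scoped Classical in
/-- The length `ℓ(w)`: the least length of a word of simple transpositions with product `w`. -/
noncomputable def length {n : ℕ} (w : Equiv.Perm (Fin n)) : ℕ := Nat.find (exists_word w)

open scoped Classical in
theorem exists_reducedWord {n : ℕ} (w : Equiv.Perm (Fin n)) :
    ∃ l : List (Fin (n - 1)), l.length = length w ∧ wordPerm l = w :=
  Nat.find_spec (exists_word w)

/-- A reduced expression of `w`. -/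
noncomputable def reducedWord {n : ℕ} (w : Equiv.Perm (Fin n)) : List (Fin (n - 1)) :=
  (exists_reducedWord w).choose

/-! ### The Hecke algebra -/

/-- The defining relations of the Hecke algebra on the free algebra in `T_1, …, T_{n-1}`. -/
inductive HeckeRel (R : Type u) [CommRing R] (q : Rˣ) (n : ℕ) :
    FreeAlgebra R (Fin (n - 1)) → FreeAlgebra R (Fin (n - 1)) → Prop
  | comm (i j : Fin (n - 1)) (h : i.1 + 1 < j.1) :
      HeckeRel R q n (FreeAlgebra.ι R i * FreeAlgebra.ι R j)
        (FreeAlgebra.ι R j * FreeAlgebra.ι R i)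
  | braid (i j : Fin (n - 1)) (h : i.1 + 1 = j.1) :
      HeckeRel R q n (FreeAlgebra.ι R i * FreeAlgebra.ι R j * FreeAlgebra.ι R i)
        (FreeAlgebra.ι R j * FreeAlgebra.ι R i * FreeAlgebra.ι R j)
  | quad (i : Fin (n - 1)) :
      HeckeRel R q n ((FreeAlgebra.ι R i + 1) *
        (FreeAlgebra.ι R i - algebraMap R (FreeAlgebra R (Fin (n - 1))) (q : R))) 0

/-- The Hecke algebra of the symmetric group on `n` letters over `R` with parameter `q`. -/
abbrev Hecke (R : Type u) [CommRing R] (q : Rˣ) (n : ℕ) : Type u := RingQuot (HeckeRel R q n)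

section

variable {R : Type u} [CommRing R] (q : Rˣ) {n : ℕ}

/-- The generator `T_i`. -/
noncomputable def gen (i : Fin (n - 1)) : Hecke R q n :=
  RingQuot.mkAlgHom R (HeckeRel R q n) (FreeAlgebra.ι R i)

/-- The element `T_w`, the product of the generators along a reduced expression of `w`. -/
noncomputable def T (w : Equiv.Perm (Fin n)) : Hecke R q n :=
  ((reducedWord w).map (gen q)).prod

theorem gen_comm (i j : Fin (n - 1)) (h : i.1 + 1 < j.1) :
    (gen q i * gen q j : Hecke R q n) = gen q j * gen q i := by
  simpa [gen] using RingQuot.mkAlgHom_rel R (HeckeRel.comm (q := q) i j h)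

theorem gen_braid (i j : Fin (n - 1)) (h : i.1 + 1 = j.1) :
    (gen q i * gen q j * gen q i : Hecke R q n) = gen q j * gen q i * gen q j := by
  simpa [gen] using RingQuot.mkAlgHom_rel R (HeckeRel.braid (q := q) i j h)

theorem gen_quad (i : Fin (n - 1)) :
    ((gen q i + 1) * (gen q i - algebraMap R (Hecke R q n) (q : R)) : Hecke R q n) = 0 := by
  simpa [gen] using RingQuot.mkAlgHom_rel R (HeckeRel.quad (q := q) i)

/-- The anti-automorphism `*` of the Hecke algebra with `T_i* = T_i`, as a homomorphism to the
opposite algebra. -/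
noncomputable def antiHom : Hecke R q n →ₐ[R] (Hecke R q n)ᵐᵒᵖ :=
  RingQuot.liftAlgHom R
    ⟨FreeAlgebra.lift R fun i ↦ MulOpposite.op (gen q i), by
      intro x y h
      induction h with
      | comm i j h =>
        simp only [map_mul, FreeAlgebra.lift_ι_apply, ← MulOpposite.op_mul, gen_comm q i j h]
      | braid i j h =>
        simp only [map_mul, FreeAlgebra.lift_ι_apply, ← MulOpposite.op_mul, ← mul_assoc,
          gen_braid q i j h]
      | quad i =>
        have h := gen_quad q i
        have e : (gen q i - algebraMap R (Hecke R q n) (q : R)) * (gen q i + 1) = 0 := by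
          rw [← h, sub_mul, mul_sub, add_mul, mul_add, mul_add, add_mul,
            Algebra.commutes (q : R) (gen q i)]
          simp only [one_mul, mul_one]
        simp only [map_mul, map_add, map_sub, map_one, map_zero, FreeAlgebra.lift_ι_apply,
          AlgHom.commutes, MulOpposite.algebraMap_apply, ← MulOpposite.op_one,
          ← MulOpposite.op_sub, ← MulOpposite.op_add, ← MulOpposite.op_mul, e,
          MulOpposite.op_zero]⟩

/-- The map `h ↦ h*`. -/
noncomputable def anti (h : Hecke R q n) : Hecke R q n := MulOpposite.unop (antiHom q h)

theorem anti_gen (i : Fin (n - 1)) : anti q (gen q i : Hecke R q n) = gen q i := by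
  simp [anti, antiHom, gen]

end

/-! ### Partitions and tableaux

A partition `μ = (μ_1, …, μ_b)` of `n` is a `Composition n` (all parts positive) with weakly
decreasing parts; `μ.length` is `b`, `μ.blocksFun` lists the parts (indexed from `0`), and
`μ.sizeUpTo k` is the partial sum `μ_1 + ⋯ + μ_k`. -/

section

variable {n : ℕ}

def IsPartition (μ : Composition n) : Prop := Antitone μ.blocksFun

/-- The dominance order `ν ⊵ μ`. -/
def Dominates (ν μ : Composition n) : Prop := ∀ k : ℕ, μ.sizeUpTo k ≤ ν.sizeUpTo k

/-- The strict dominance order `ν ▷ μ`. -/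
def StrictlyDominates (ν μ : Composition n) : Prop := Dominates ν μ ∧ ν ≠ μ

/-- A `μ`-tableau in which each of the `n` letters occurs exactly once: the node in row `r` and
column `c` is `⟨r, c⟩`. -/
abbrev Tableau (μ : Composition n) : Type :=
  (Σ r : Fin μ.length, Fin (μ.blocksFun r)) ≃ Fin n

/-- The tableau `𝔱^μ`, with the letters in order along the rows, from top to bottom. -/
def initialTableau (μ : Composition n) : Tableau μ := μ.blocksFinEquiv

/-- The permutation `d(𝔱)` with `𝔱 = 𝔱^μ d(𝔱)` (right action on the entries). -/
def Tableau.perm {μ : Composition n} (t : Tableau μ) : Equiv.Perm (Fin n) :=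
  (initialTableau μ).symm.trans t

/-- Standard tableaux: the entries increase along the rows and down the columns. -/
def Tableau.IsStandard {μ : Composition n} (t : Tableau μ) : Prop :=
  (∀ (r : Fin μ.length) (c c' : Fin (μ.blocksFun r)), c < c' → t ⟨r, c⟩ < t ⟨r, c'⟩) ∧
  (∀ (r r' : Fin μ.length) (c : Fin (μ.blocksFun r)) (c' : Fin (μ.blocksFun r')),
    r < r' → c.1 = c'.1 → t ⟨r, c⟩ < t ⟨r', c'⟩)

/-- The row stabilizer of `𝔱^μ`. -/
def rowStabilizer (μ : Composition n) : Set (Equiv.Perm (Fin n)) :=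
  {w | ∀ i, ((initialTableau μ).symm (w i)).1 = ((initialTableau μ).symm i).1}

/-- The symmetric group on the letters `m + 1, …, m + k` (from `m` to `m + k - 1` in `Fin n`). -/
def symOn (n m k : ℕ) : Set (Equiv.Perm (Fin n)) :=
  {w | ∀ i : Fin n, ¬ (m ≤ i.1 ∧ i.1 < m + k) → w i = i}

/-- For `η = (η_1, …, η_l)`, the subgroup of the symmetric group on the letters
`m + 1, …, m + η_1 + ⋯ + η_l` preserving each of the consecutive blocks of sizes `η_1, …, η_l`. -/
def blockStabilizer (n m : ℕ) (η : List ℕ) : Set (Equiv.Perm (Fin n)) :=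
  {w | w ∈ symOn n m η.sum ∧ ∀ (k : ℕ) (i : Fin n),
    m + (η.take k).sum ≤ i.1 → i.1 < m + (η.take (k + 1)).sum →
      m + (η.take k).sum ≤ (w i).1 ∧ (w i).1 < m + (η.take (k + 1)).sum}

/-- The set `𝒟_{m,η}` of minimal length right coset representatives of `blockStabilizer n m η` in
`symOn n m η.sum`.  The right coset of `w` consists of the products "first `v`, then `w`". -/
def cosetReps (n m : ℕ) (η : List ℕ) : Set (Equiv.Perm (Fin n)) :=
  {w | w ∈ symOn n m η.sum ∧ ∀ v ∈ blockStabilizer n m η, length w ≤ length (w * v)}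

end

/-! ### Murphy's elements and the ideals -/

section

variable {R : Type u} [CommRing R] (q : Rˣ) {n : ℕ}

open scoped Classical in
/-- `m_μ`, the sum of `T_w` over the row stabilizer of `𝔱^μ`. -/
noncomputable def mElt (μ : Composition n) : Hecke R q n :=
  ∑ w : Equiv.Perm (Fin n) with w ∈ rowStabilizer μ, T q w

/-- The right module `M^μ = m_μ ℋ`, a right ideal. -/
noncomputable def permModule (μ : Composition n) : Submodule (Hecke R q n)ᵐᵒᵖ (Hecke R q n) :=
  Submodule.span (Hecke R q n)ᵐᵒᵖ {mElt q μ}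

/-- `m_{𝔰𝔱} = T_{d(𝔰)}* m_μ T_{d(𝔱)}`. -/
noncomputable def murphy {μ : Composition n} (s t : Tableau μ) : Hecke R q n :=
  anti q (T q s.perm) * mElt q μ * T q t.perm

/-- `ℋ^{▷μ}`, the `R`-span of the `m_{𝔰𝔱}` for standard `ν`-tableaux `𝔰`, `𝔱` with `ν ▷ μ`. -/
noncomputable def cellIdeal (μ : Composition n) : Submodule R (Hecke R q n) :=
  Submodule.span R {x | ∃ ν : Composition n, IsPartition ν ∧ StrictlyDominates ν μ ∧
    ∃ s t : Tableau ν, s.IsStandard ∧ t.IsStandard ∧ x = murphy q s t}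

open scoped Classical in
/-- `C(m; η)`, the sum of `T_w` over `𝒟_{m,η}`. -/
noncomputable def cosetSum (m : ℕ) (η : List ℕ) : Hecke R q n :=
  ∑ w : Equiv.Perm (Fin n) with w ∈ cosetReps n m η, T q w

/-- `h_{d+1,t} = C(μ_1 + ⋯ + μ_d; μ_{d+1}, t)`; the row index `d` is counted from `0`. -/
noncomputable def hElt (μ : Composition n) (d : Fin μ.length) (t : ℕ) : Hecke R q n :=
  cosetSum q (μ.sizeUpTo d) [μ.blocksFun d, t]

/-- The right ideal generated by the `m_μ h_{d,t}` with `1 ≤ d < b` and `1 ≤ t ≤ μ_{d+1}` (here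
`d` is counted from `0`). -/
noncomputable def hIdeal (μ : Composition n) : Submodule (Hecke R q n)ᵐᵒᵖ (Hecke R q n) :=
  Submodule.span (Hecke R q n)ᵐᵒᵖ {x | ∃ (d : ℕ) (hd : d + 1 < μ.length) (t : ℕ),
    1 ≤ t ∧ t ≤ μ.blocksFun ⟨d + 1, hd⟩ ∧ x = mElt q μ * hElt q μ ⟨d, Nat.lt_of_succ_lt hd⟩ t}

end

end HeckeTypeA

/-! The generators lie in `ℋ^{▷μ}` for the following reason. Cut off the first `t` letters of the
row below row `d`. The finer row stabilizer has a sum `m'` with `m_μ = h * m'` for some `h`, and `m'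
* h_{d,t}` is the sum `m_g` for the blocks in which these `t` letters have joined row `d`. Hence
`m_μ h_{d,t}` is a left multiple of `m_g`. Sorting the blocks of `g` by size conjugates `m_g`,
through an invertible `T_x`, to `m_ν` for a partition `ν ▷ μ` (`exists_mElt_mul_hElt_eq`). That `ℋ
m_ν ℋ` is spanned by Murphy elements of shapes `⊵ ν` is `mul_mElt_mul_mem`, an induction from the
most dominant shape downwards that uses straightening on both sides of `m_ν`.

Straightening (`mElt_mul_mem`) says that modulo the right ideal `ℐ`, `M^μ` is spanned by the `m_μ
T_{d(𝔱)}` with `𝔱` standard. If `𝔱^μ w` increases along rows but is not standard, two adjacent rows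
violate the order in some column. The Garnir sum over shuffles of the end of the upper row with the
beginning of the lower one then has a right multiple with leading term `T_w` and shorter remainder.
These Garnir sums, multiplied by `m_μ`, lie in `ℐ` by a `q`-Pascal recursion that starts from the
`h_{d,t}` (`symSum_mul_shuffleSum_mem`).

Conversely, the `m_μ T_{d(𝔱)}` are linearly independent modulo `ℋ^{▷μ}`. Let `w₀` read the diagram
down its columns and let `n` be the signed sum over the column stabilizer. The product `m_ν T_w n`
vanishes as soon as `w` puts two letters of a row into one column. By pigeonhole this happens for
every `w` when `ν ▷ μ`, and for `ν = μ` whenever `w ≠ w₀` is not longer than `w₀`; but `m_μ T_{w₀} n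
≠ 0` unless `R` is trivial. As every `d(𝔱)` is an initial factor of `w₀`, with lengths adding up,
multiplying a relation by a suitable `T_v n` isolates a coefficient of a longest `d(𝔱)`.

An element of the intersection is therefore an element of `ℐ` plus a standard combination in
`ℋ^{▷μ}`, and the latter is zero. -/

namespace HeckeTypeA

universe u

/-! ### Inversions and length -/

section Length

variable {n : ℕ}

/-- The smaller letter moved by the simple transposition `i`. -/
def lo (i : Fin (n - 1)) : Fin n := ⟨i.1, by omega⟩

/-- The larger letter moved by the simple transposition `i`. -/
def hi (i : Fin (n - 1)) : Fin n := ⟨i.1 + 1, by omega⟩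

@[simp] theorem lo_val (i : Fin (n - 1)) : (lo i).1 = i.1 := rfl

@[simp] theorem hi_val (i : Fin (n - 1)) : (hi i).1 = i.1 + 1 := rfl

theorem lo_lt_hi (i : Fin (n - 1)) : lo i < hi i := by simp [Fin.lt_def]

theorem lo_ne_hi (i : Fin (n - 1)) : lo i ≠ hi i := (lo_lt_hi i).ne

@[simp] theorem simple_lo (i : Fin (n - 1)) : simple i (lo i) = hi i := Equiv.swap_apply_left _ _

@[simp] theorem simple_hi (i : Fin (n - 1)) : simple i (hi i) = lo i := Equiv.swap_apply_right _ _

theorem simple_of_ne (i : Fin (n - 1)) {x : Fin n} (h1 : x ≠ lo i) (h2 : x ≠ hi i) :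
    simple i x = x := Equiv.swap_apply_of_ne_of_ne h1 h2

@[simp] theorem simple_mul_self (i : Fin (n - 1)) : simple i * simple i = 1 :=
  Equiv.swap_mul_self _ _

@[simp] theorem simple_simple (i : Fin (n - 1)) (x : Fin n) : simple i (simple i x) = x :=
  Equiv.swap_apply_self _ _ _

@[simp] theorem simple_inv (i : Fin (n - 1)) : (simple i)⁻¹ = simple i := Equiv.swap_inv _ _

@[simp] theorem mul_simple_mul_simple (w : Equiv.Perm (Fin n)) (i : Fin (n - 1)) :
    w * simple i * simple i = w := by simp [mul_assoc]

@[simp] theorem simple_mul_simple_mul (w : Equiv.Perm (Fin n)) (i : Fin (n - 1)) :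
    simple i * (simple i * w) = w := by simp [← mul_assoc]

theorem simple_val (i : Fin (n - 1)) (x : Fin n) :
    (simple i x).1 = if x.1 = i.1 then i.1 + 1 else if x.1 = i.1 + 1 then i.1 else x.1 := by
  split_ifs with h1 h2
  · rw [show x = lo i from Fin.ext h1]; simp
  · rw [show x = hi i from Fin.ext h2]; simp
  · rw [simple_of_ne i (fun h ↦ h1 (by simp [h])) (fun h ↦ h2 (by simp [h]))]

theorem simple_comm (i j : Fin (n - 1)) (h : i.1 + 1 < j.1) :
    simple i * simple j = simple j * simple i := by
  have h1 : simple i (lo j) = lo j := simple_of_ne i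
    (by simp [Fin.ext_iff]; omega) (by simp [Fin.ext_iff]; omega)
  have h2 : simple i (hi j) = hi j := simple_of_ne i
    (by simp [Fin.ext_iff]; omega) (by simp [Fin.ext_iff]; omega)
  rw [← mul_inv_eq_iff_eq_mul, show simple j = Equiv.swap (lo j) (hi j) from rfl,
    ← Equiv.swap_apply_apply, h1, h2]

theorem simple_braid (i j : Fin (n - 1)) (h : i.1 + 1 = j.1) :
    simple i * (simple j * simple i) = simple j * (simple i * simple j) := by
  have e : hi i = lo j := Fin.ext h
  have h1 : simple j (lo i) = lo i := simple_of_ne j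
    (by simp [Fin.ext_iff]; omega) (by simp [Fin.ext_iff]; omega)
  have h2 : simple i (hi j) = hi j := simple_of_ne i
    (by simp [Fin.ext_iff]; omega) (by simp [Fin.ext_iff]; omega)
  have e1 : simple i * simple j * (simple i)⁻¹ = Equiv.swap (lo i) (hi j) := by
    rw [show simple j = Equiv.swap (lo j) (hi j) from rfl, ← Equiv.swap_apply_apply, h2, ← e,
      simple_hi]
  have e2 : simple j * simple i * (simple j)⁻¹ = Equiv.swap (lo i) (hi j) := by
    rw [show simple i = Equiv.swap (lo i) (hi i) from rfl, ← Equiv.swap_apply_apply, h1, e,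
      simple_lo]
  simpa [mul_assoc] using e1.trans e2.symm

theorem simple_lt_simple (i : Fin (n - 1)) {x y : Fin n} (hxy : x < y)
    (h : ¬ (x = lo i ∧ y = hi i)) : simple i x < simple i y := by
  simp only [Fin.lt_def, Fin.ext_iff, simple_val, lo_val, hi_val] at *
  split_ifs <;> omega

theorem apply_lo_ne_apply_hi (w : Equiv.Perm (Fin n)) (i : Fin (n - 1)) : w (lo i) ≠ w (hi i) :=
  fun h ↦ lo_ne_hi i (w.injective h)

/-- The inversions of a permutation. -/
def inversions (w : Equiv.Perm (Fin n)) : Finset (Fin n × Fin n) :=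
  {p | p.1 < p.2 ∧ w p.2 < w p.1}

@[simp] theorem mem_inversions {w : Equiv.Perm (Fin n)} {p : Fin n × Fin n} :
    p ∈ inversions w ↔ p.1 < p.2 ∧ w p.2 < w p.1 := by simp [inversions]

/-- The transposition preserves the order of every pair except its own, so it carries the old
inversions to new ones, and the only further inversion is its own pair. -/
theorem card_inversions_mul_simple {w : Equiv.Perm (Fin n)} {i : Fin (n - 1)}
    (h : w (lo i) < w (hi i)) :
    (inversions (w * simple i)).card = (inversions w).card + 1 := by
  have hnot : (lo i, hi i) ∉ (inversions w).map
      ((simple i).toEmbedding.prodMap (simple i).toEmbedding) := by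
    simp only [Finset.mem_map, mem_inversions, not_exists, not_and]
    rintro ⟨a, b⟩ ⟨hab, -⟩ e
    simp only [Function.Embedding.coe_prodMap, Prod.map_apply, Prod.mk.injEq,
      Equiv.coe_toEmbedding] at e
    have ha : a = hi i := by rw [← simple_simple i a, e.1, simple_lo]
    have hb : b = lo i := by rw [← simple_simple i b, e.2, simple_hi]
    subst ha hb
    exact absurd hab (lo_lt_hi i).le.not_gt
  have key : inversions (w * simple i) = Finset.cons (lo i, hi i) _ hnot := by
    ext ⟨a, b⟩
    simp only [mem_inversions, Equiv.Perm.mul_apply, Finset.mem_cons, Finset.mem_map, Prod.exists,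
      Function.Embedding.coe_prodMap, Prod.map_apply, Prod.mk.injEq, Equiv.coe_toEmbedding]
    constructor
    · rintro ⟨hab, hw⟩
      by_cases hc : a = lo i ∧ b = hi i
      · exact Or.inl hc
      · exact Or.inr ⟨simple i a, simple i b, ⟨simple_lt_simple i hab hc, hw⟩, by simp, by simp⟩
    · rintro (⟨rfl, rfl⟩ | ⟨a, b, ⟨hab, hw⟩, rfl, rfl⟩)
      · exact ⟨lo_lt_hi i, by simpa using h⟩
      · refine ⟨simple_lt_simple i hab ?_, by simpa using hw⟩
        rintro ⟨rfl, rfl⟩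
        exact hw.not_gt h
  rw [key, Finset.card_cons, Finset.card_map]

theorem wordPerm_cons (i : Fin (n - 1)) (l : List (Fin (n - 1))) :
    wordPerm (i :: l) = wordPerm l * simple i := by simp [wordPerm]

@[simp] theorem wordPerm_nil : wordPerm ([] : List (Fin (n - 1))) = 1 := rfl

theorem wordPerm_append (l l' : List (Fin (n - 1))) :
    wordPerm (l ++ l') = wordPerm l' * wordPerm l := by simp [wordPerm]

theorem card_inversions_mul_simple_of_gt {w : Equiv.Perm (Fin n)} {i : Fin (n - 1)}
    (h : w (hi i) < w (lo i)) :
    (inversions w).card = (inversions (w * simple i)).card + 1 := by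
  rw [← card_inversions_mul_simple (w := w * simple i) (i := i) (by simpa using h)]
  simp

theorem card_inversions_wordPerm_le (l : List (Fin (n - 1))) :
    (inversions (wordPerm l)).card ≤ l.length := by
  induction l with
  | nil =>
    simp only [wordPerm_nil, List.length_nil, Nat.le_zero, Finset.card_eq_zero]
    ext p
    simp only [mem_inversions, Equiv.Perm.coe_one, id, Finset.notMem_empty, iff_false, not_and,
      not_lt]
    exact fun h ↦ h.le
  | cons i l ih =>
    rw [wordPerm_cons, List.length_cons]
    rcases lt_or_gt_of_ne (apply_lo_ne_apply_hi (wordPerm l) i) with h | h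
    · rw [card_inversions_mul_simple h]; omega
    · have := card_inversions_mul_simple_of_gt h; omega

/-- A function that increases at consecutive letters of each block of a monotone labelling
increases on each block. -/
theorem lt_of_forall_lo_lt_hi {f : Fin n → ℕ} (hf : Monotone f) {w : Fin n → Fin n}
    (h : ∀ i : Fin (n - 1), f (lo i) = f (hi i) → w (lo i) < w (hi i)) {i j : Fin n} (hij : i < j)
    (hfij : f i = f j) : w i < w j := by
  obtain ⟨i, hi'⟩ := i
  obtain ⟨j, hj⟩ := j
  rw [Fin.lt_def] at hij
  simp only at hij
  induction j, hij using Nat.le_induction with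
  | base => exact h ⟨i, by omega⟩ hfij
  | succ j hij ih =>
    have h1 : f ⟨i, hi'⟩ ≤ f ⟨j, by omega⟩ := hf (by rw [Fin.le_def]; simp only; omega)
    have h2 : f ⟨j, by omega⟩ ≤ f ⟨j + 1, hj⟩ := hf (by rw [Fin.le_def]; simp only; omega)
    exact (ih (by omega) (by omega)).trans (h ⟨j, by omega⟩ (by simp only [lo, hi]; omega))

theorem eq_one_of_lt {w : Equiv.Perm (Fin n)} (h : ∀ i j, i < j → w i < w j) : w = 1 :=
  (Equiv.Perm.monotone_iff w).1 (StrictMono.monotone fun i j ↦ h i j)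

theorem exists_descent {w : Equiv.Perm (Fin n)} (h : w ≠ 1) :
    ∃ i : Fin (n - 1), w (hi i) < w (lo i) := by
  by_contra! hc
  refine h (eq_one_of_lt fun i j hij ↦ ?_)
  exact lt_of_forall_lo_lt_hi (f := fun _ ↦ 0) monotone_const
    (fun i _ ↦ (hc i).lt_of_ne (apply_lo_ne_apply_hi w i)) hij rfl

/-- Bubble sort: removing a descent removes exactly one inversion. -/
theorem exists_word_card_inversions (w : Equiv.Perm (Fin n)) :
    ∃ l : List (Fin (n - 1)), l.length = (inversions w).card ∧ wordPerm l = w := by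
  induction hk : (inversions w).card generalizing w with
  | zero =>
    refine ⟨[], rfl, ?_⟩
    by_contra hw
    obtain ⟨i, hi'⟩ := exists_descent (Ne.symm hw)
    have := card_inversions_mul_simple_of_gt hi'
    omega
  | succ k ih =>
    have hw : w ≠ 1 := by
      rintro rfl
      have := card_inversions_wordPerm_le ([] : List (Fin (n - 1)))
      simp only [wordPerm_nil, List.length_nil] at this
      omega
    obtain ⟨i, hi'⟩ := exists_descent hw
    have := card_inversions_mul_simple_of_gt hi'
    obtain ⟨l, hl, hl'⟩ := ih (w * simple i) (by omega)
    exact ⟨i :: l, by simp [hl], by rw [wordPerm_cons, hl', mul_simple_mul_simple]⟩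

theorem length_eq_card_inversions (w : Equiv.Perm (Fin n)) :
    length w = (inversions w).card := by
  classical
  apply le_antisymm
  · exact Nat.find_min' (exists_word w) (exists_word_card_inversions w)
  · obtain ⟨l, hl, hl'⟩ := exists_reducedWord w
    rw [← hl, ← hl']
    exact card_inversions_wordPerm_le l

theorem length_wordPerm_le (l : List (Fin (n - 1))) : length (wordPerm l) ≤ l.length := by
  rw [length_eq_card_inversions]
  exact card_inversions_wordPerm_le l

theorem length_mul_simple {w : Equiv.Perm (Fin n)} {i : Fin (n - 1)} (h : w (lo i) < w (hi i)) :
    length (w * simple i) = length w + 1 := by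
  simp only [length_eq_card_inversions, card_inversions_mul_simple h]

theorem length_mul_simple_of_gt {w : Equiv.Perm (Fin n)} {i : Fin (n - 1)}
    (h : w (hi i) < w (lo i)) : length w = length (w * simple i) + 1 := by
  simp only [length_eq_card_inversions, ← card_inversions_mul_simple_of_gt h]

@[simp] theorem length_one : length (1 : Equiv.Perm (Fin n)) = 0 := by
  simpa using length_wordPerm_le ([] : List (Fin (n - 1)))

theorem eq_one_of_length_eq_zero {w : Equiv.Perm (Fin n)} (h : length w = 0) : w = 1 := by
  by_contra hw
  obtain ⟨i, hi'⟩ := exists_descent hw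
  have := length_mul_simple_of_gt hi'
  omega

theorem length_inv (w : Equiv.Perm (Fin n)) : length w⁻¹ = length w := by
  simp only [length_eq_card_inversions]
  refine Finset.card_bij' (fun p _ ↦ (w⁻¹ p.2, w⁻¹ p.1)) (fun p _ ↦ (w p.2, w p.1)) ?_ ?_ ?_ ?_ <;>
    simp +contextual

theorem length_simple_mul_of_gt {w : Equiv.Perm (Fin n)} {i : Fin (n - 1)}
    (h : w⁻¹ (hi i) < w⁻¹ (lo i)) : length w = length (simple i * w) + 1 := by
  rw [← length_inv, length_mul_simple_of_gt h, ← length_inv (simple i * w), mul_inv_rev, simple_inv]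

/-- The inversion set records the relative order of all values, so `v * u⁻¹` is increasing. -/
theorem inversions_injective : Function.Injective (inversions (n := n)) := by
  intro u v h
  have key : ∀ i j, u i < u j → v i < v j := by
    intro i j hij
    have hne : i ≠ j := by rintro rfl; exact hij.false
    have hv : v i ≠ v j := fun e ↦ hne (v.injective e)
    rcases lt_or_gt_of_ne hne with hlt | hlt
    · by_contra hc
      have : (i, j) ∈ inversions u := by
        rw [h]; simpa [hlt] using lt_of_le_of_ne (not_lt.1 hc) hv.symm
      exact hij.not_gt (mem_inversions.1 this).2
    · have : (j, i) ∈ inversions v := by rw [← h]; simpa [hlt] using hij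
      exact (mem_inversions.1 this).2
  have : v * u⁻¹ = 1 := eq_one_of_lt fun i j hij ↦ key _ _ (by simpa using hij)
  exact (mul_inv_eq_one.1 this).symm

end Length

/-! ### The elements `T_w` -/

section Basis

variable {R : Type u} [CommRing R] (q : Rˣ) {n : ℕ}

theorem gen_mul_self (i : Fin (n - 1)) :
    (gen q i * gen q i : Hecke R q n) = ((q : R) - 1) • gen q i + (q : R) • 1 := by
  have h := gen_quad q i
  rw [mul_sub, add_mul, add_mul, one_mul, one_mul, ← Algebra.commutes,
    ← Algebra.smul_def] at h
  rw [Algebra.algebraMap_eq_smul_one] at h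
  rw [sub_eq_zero] at h
  have e : (gen q i * gen q i : Hecke R q n) = gen q i * gen q i + gen q i - gen q i := by abel
  rw [e, h, sub_smul (q : R) 1 (gen q i : Hecke R q n), one_smul]
  abel

/-- Matsumoto's theorem. The first letters `i` and `j` of two reduced words of `w` are both descents
of `w`, so there are also reduced words starting with the two sides of the relation between `i` and
`j` and sharing their tail. Induction links each given word to one of these. -/
theorem prod_gen_eq_of_wordPerm_eq (k : ℕ) (l l' : List (Fin (n - 1))) (hl : l.length = k)
    (hl' : l'.length = k) (h : wordPerm l = wordPerm l') (hk : length (wordPerm l) = k) :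
    ((l.map (gen q)).prod : Hecke R q n) = (l'.map (gen q)).prod := by
  induction k using Nat.strong_induction_on generalizing l l' with
  | _ k ih =>
    cases l with
    | nil =>
      simp only [List.length_nil] at hl
      subst hl
      rw [List.length_eq_zero_iff.1 hl']
    | cons i l =>
    cases l' with
    | nil => simp only [List.length_nil] at hl'; simp only [List.length_cons] at hl; omega
    | cons j l' =>
    obtain _ | k := k
    · simp at hl
    simp only [List.length_cons, Nat.add_right_cancel_iff] at hl hl'
    obtain ⟨w, hw⟩ : ∃ w, w = wordPerm (i :: l) := ⟨_, rfl⟩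
    rw [← hw] at hk h
    have hwi : wordPerm l = w * simple i := by rw [hw, wordPerm_cons, mul_simple_mul_simple]
    have hwj : wordPerm l' = w * simple j := by rw [h, wordPerm_cons, mul_simple_mul_simple]
    have hli : length (w * simple i) = k := by
      have h1 := length_wordPerm_le l
      rw [hwi] at h1
      rcases lt_or_gt_of_ne (apply_lo_ne_apply_hi w i) with h | h
      · have := length_mul_simple h; omega
      · have := length_mul_simple_of_gt h; omega
    have hlj : length (w * simple j) = k := by
      have h1 := length_wordPerm_le l'
      rw [hwj] at h1
      rcases lt_or_gt_of_ne (apply_lo_ne_apply_hi w j) with h | h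
      · have := length_mul_simple h; omega
      · have := length_mul_simple_of_gt h; omega
    have hdi : w (hi i) < w (lo i) := by
      rcases lt_or_gt_of_ne (apply_lo_ne_apply_hi w i) with h | h
      · have := length_mul_simple h; omega
      · exact h
    have hdj : w (hi j) < w (lo j) := by
      rcases lt_or_gt_of_ne (apply_lo_ne_apply_hi w j) with h | h
      · have := length_mul_simple h; omega
      · exact h
    clear hw h hk
    have sym : ∀ (i j : Fin (n - 1)) (l l' : List (Fin (n - 1))), l.length = k → l'.length = k →
        wordPerm l = w * simple i → wordPerm l' = w * simple j → length (w * simple i) = k →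
        length (w * simple j) = k → w (hi i) < w (lo i) → w (hi j) < w (lo j) → i.1 ≤ j.1 →
        (((i :: l).map (gen q)).prod : Hecke R q n) = ((j :: l').map (gen q)).prod := by
      clear! i j l l'
      intro i j l l' hl hl' hwi hwj hli hlj hdi hdj hij
      simp only [List.map_cons, List.prod_cons]
      rcases hij.eq_or_lt with hij | hij
      · obtain rfl : i = j := Fin.ext hij
        rw [ih k (by omega) l l' hl hl' (by rw [hwi, hwj]) (by rw [hwi, hli])]
      rcases (Nat.succ_le_of_lt hij).eq_or_lt with hij' | hij'
      · have e : hi i = lo j := Fin.ext hij'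
        have s1 : simple j (lo i) = lo i := simple_of_ne j
          (by simp [Fin.ext_iff]; omega) (by simp [Fin.ext_iff]; omega)
        have s2 : simple i (hi j) = hi j := simple_of_ne i
          (by simp [Fin.ext_iff]; omega) (by simp [Fin.ext_iff]; omega)
        -- Descents at both `i` and `j` reverse three consecutive letters, so all three factors of
        -- the braid can be removed, leaving a common tail `r` of length `k - 2`.
        have d1 := length_mul_simple_of_gt (w := w * simple i) (i := j)
          (by simpa [s2, ← e] using hdj.trans_le (e ▸ hdi.le))
        have d2 := length_mul_simple_of_gt (w := w * simple i * simple j) (i := i)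
          (by simpa [s1, e, s2] using hdj)
        have hb : w * simple i * simple j * simple i = w * simple j * simple i * simple j := by
          simpa only [mul_assoc] using congrArg (w * ·) (simple_braid i j hij')
        obtain ⟨r, hr, hr'⟩ := exists_reducedWord (w * simple i * simple j * simple i)
        have p1 : wordPerm (j :: i :: r) = w * simple i := by
          simp [wordPerm_cons, hr']
        have p2 : wordPerm (i :: j :: r) = w * simple j := by
          simp [wordPerm_cons, hr', hb]
        rw [ih k (by omega) l (j :: i :: r) hl (by simp [hr]; omega) (by rw [hwi, p1])
            (by rw [hwi, hli]),
          ih k (by omega) l' (i :: j :: r) hl' (by simp [hr]; omega) (by rw [hwj, p2])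
            (by rw [hwj, hlj])]
        simp only [List.map_cons, List.prod_cons, ← mul_assoc]
        rw [gen_braid q i j hij']
      · have s1 : simple i (lo j) = lo j := simple_of_ne i
          (by simp [Fin.ext_iff]; omega) (by simp [Fin.ext_iff]; omega)
        have s2 : simple i (hi j) = hi j := simple_of_ne i
          (by simp [Fin.ext_iff]; omega) (by simp [Fin.ext_iff]; omega)
        have d1 := length_mul_simple_of_gt (w := w * simple i) (i := j)
          (by simpa [s1, s2] using hdj)
        have hb : w * simple i * simple j = w * simple j * simple i := by
          simpa only [mul_assoc] using congrArg (w * ·) (simple_comm i j hij')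
        obtain ⟨r, hr, hr'⟩ := exists_reducedWord (w * simple i * simple j)
        have p1 : wordPerm (j :: r) = w * simple i := by simp [wordPerm_cons, hr']
        have p2 : wordPerm (i :: r) = w * simple j := by simp [wordPerm_cons, hr', hb]
        rw [ih k (by omega) l (j :: r) hl (by simp [hr]; omega) (by rw [hwi, p1])
            (by rw [hwi, hli]),
          ih k (by omega) l' (i :: r) hl' (by simp [hr]; omega) (by rw [hwj, p2])
            (by rw [hwj, hlj])]
        simp only [List.map_cons, List.prod_cons, ← mul_assoc]
        rw [gen_comm q i j hij']
    rcases le_total i.1 j.1 with hij | hij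
    · exact sym i j l l' hl hl' hwi hwj hli hlj hdi hdj hij
    · exact (sym j i l' l hl' hl hwj hwi hlj hli hdj hdi hij).symm

theorem T_wordPerm (l : List (Fin (n - 1))) (hl : length (wordPerm l) = l.length) :
    (T q (wordPerm l) : Hecke R q n) = (l.map (gen q)).prod := by
  have h := (exists_reducedWord (wordPerm l)).choose_spec
  exact prod_gen_eq_of_wordPerm_eq q l.length _ l (h.1.trans hl) rfl h.2
    ((congrArg length h.2).trans hl)

@[simp] theorem T_one : (T q (1 : Equiv.Perm (Fin n)) : Hecke R q n) = 1 := by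
  simpa using T_wordPerm q ([] : List (Fin (n - 1))) (by simp)

theorem gen_mul_T {w : Equiv.Perm (Fin n)} {i : Fin (n - 1)} (h : w (lo i) < w (hi i)) :
    (gen q i * T q w : Hecke R q n) = T q (w * simple i) := by
  obtain ⟨l, hl, rfl⟩ := exists_reducedWord w
  rw [← wordPerm_cons, T_wordPerm q l hl.symm, T_wordPerm q (i :: l), List.map_cons,
    List.prod_cons]
  rw [wordPerm_cons, length_mul_simple h, List.length_cons, hl]

theorem gen_mul_T_of_gt {w : Equiv.Perm (Fin n)} {i : Fin (n - 1)} (h : w (hi i) < w (lo i)) :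
    (gen q i * T q w : Hecke R q n) =
      (q : R) • T q (w * simple i) + ((q : R) - 1) • T q w := by
  have h1 := gen_mul_T (R := R) q (w := w * simple i) (i := i) (by simpa using h)
  rw [mul_simple_mul_simple] at h1
  rw [← h1, ← mul_assoc, gen_mul_self, add_mul, smul_mul_assoc, smul_mul_assoc, one_mul, add_comm]

@[simp] theorem anti_mul (x y : Hecke R q n) : anti q (x * y) = anti q y * anti q x := by
  simp [anti]

@[simp] theorem anti_one : anti q (1 : Hecke R q n) = 1 := by simp [anti]

@[simp] theorem anti_add (x y : Hecke R q n) : anti q (x + y) = anti q x + anti q y := by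
  simp [anti]

@[simp] theorem anti_zero : anti q (0 : Hecke R q n) = 0 := by simp [anti]

@[simp] theorem anti_smul (r : R) (x : Hecke R q n) : anti q (r • x) = r • anti q x := by
  simp [anti]

theorem anti_sum {ι : Type*} (s : Finset ι) (x : ι → Hecke R q n) :
    anti q (∑ i ∈ s, x i) = ∑ i ∈ s, anti q (x i) := by
  simp [anti]

theorem T_induction (P : Equiv.Perm (Fin n) → Prop) (one : P 1)
    (step : ∀ w i, w (lo i) < w (hi i) → P w → P (w * simple i)) (w : Equiv.Perm (Fin n)) :
    P w := by
  induction hk : length w generalizing w with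
  | zero => rwa [eq_one_of_length_eq_zero hk]
  | succ k ih =>
    have hw : w ≠ 1 := by rintro rfl; simp at hk
    obtain ⟨i, hi'⟩ := exists_descent hw
    have h1 := length_mul_simple_of_gt hi'
    simpa using step (w * simple i) i (by simpa using hi') (ih _ (by omega))

end Basis

/-! ### Products of the `T_w` and the basis they form. -/

section Multiplication

variable {R : Type u} [CommRing R] (q : Rˣ) {n : ℕ}

theorem length_mul_le (v u : Equiv.Perm (Fin n)) : length (v * u) ≤ length u + length v := by
  obtain ⟨l, hl, hl'⟩ := exists_reducedWord u
  obtain ⟨k, hk, hk'⟩ := exists_reducedWord v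
  rw [← hl', ← hk', ← wordPerm_append, hl', hk', ← hl, ← hk, ← List.length_append]
  exact length_wordPerm_le _

/-- If `w` inverts no pair of letters that `u⁻¹` inverts, then `T_u T_w = T_{uw}` and lengths
add up. -/
theorem T_mul_T_and_length {u w : Equiv.Perm (Fin n)}
    (h : ∀ i j, i < j → u j < u i → w (u j) < w (u i)) :
    (T q u * T q w : Hecke R q n) = T q (w * u) ∧ length (w * u) = length u + length w := by
  induction u using T_induction with
  | one => simp
  | step u i hi' ih =>
    obtain ⟨h1, h2⟩ := ih fun a b hab hu ↦ by
      have hne : ¬ (a = lo i ∧ b = hi i) := by rintro ⟨rfl, rfl⟩; exact hu.not_gt hi'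
      simpa using h (simple i a) (simple i b) (simple_lt_simple i hab hne) (by simpa using hu)
    have hlt : (w * u) (lo i) < (w * u) (hi i) := by
      simpa using h (lo i) (hi i) (lo_lt_hi i) (by simpa using hi')
    rw [← gen_mul_T q hi', mul_assoc, h1, gen_mul_T q hlt, length_mul_simple hi', ← mul_assoc,
      length_mul_simple hlt, h2]
    exact ⟨rfl, by omega⟩

theorem T_mul_T {u w : Equiv.Perm (Fin n)} (h : ∀ i j, i < j → u j < u i → w (u j) < w (u i)) :
    (T q u * T q w : Hecke R q n) = T q (w * u) := (T_mul_T_and_length q h).1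

/-- Lengths do not involve the coefficients, so any parameter will do; here it is `1` over `ℤ`. -/
theorem length_mul_of_forall {u w : Equiv.Perm (Fin n)}
    (h : ∀ i j, i < j → u j < u i → w (u j) < w (u i)) :
    length (w * u) = length u + length w := (T_mul_T_and_length (1 : ℤˣ) h).2

theorem T_simple (i : Fin (n - 1)) : (T q (simple i) : Hecke R q n) = gen q i := by
  simpa using (gen_mul_T (R := R) q (w := 1) (i := i) (lo_lt_hi i)).symm

theorem T_mul_gen {w : Equiv.Perm (Fin n)} {i : Fin (n - 1)} (h : w⁻¹ (lo i) < w⁻¹ (hi i)) :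
    (T q w * gen q i : Hecke R q n) = T q (simple i * w) := by
  rw [← T_simple]
  refine T_mul_T q fun a b hab hw ↦ simple_lt_simple i hw ?_
  rintro ⟨h1, h2⟩
  rw [← h1, ← h2] at h
  exact h.not_gt (by simpa using hab)

theorem anti_T (w : Equiv.Perm (Fin n)) : anti q (T q w : Hecke R q n) = T q w⁻¹ := by
  induction w using T_induction with
  | one => simp
  | step w i hi' ih =>
    rw [← gen_mul_T q hi', anti_mul, ih, anti_gen, T_mul_gen q (by simpa using hi'), mul_inv_rev,
      simple_inv]

/-- The operator on functions on `𝔖_n` giving left multiplication by `T_i` in terms of the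
coordinates with respect to the elements `T_w`. -/
noncomputable def leftMul (i : Fin (n - 1)) :
    (Equiv.Perm (Fin n) → R) →ₗ[R] (Equiv.Perm (Fin n) → R) where
  toFun f w := if w (lo i) < w (hi i) then (q : R) * f (w * simple i)
    else f (w * simple i) + ((q : R) - 1) * f w
  map_add' f g := by ext w; simp only [Pi.add_apply]; split_ifs <;> ring
  map_smul' r f := by
    ext w; simp only [Pi.smul_apply, smul_eq_mul, RingHom.id_apply]; split_ifs <;> ring

theorem leftMul_apply (i : Fin (n - 1)) (f : Equiv.Perm (Fin n) → R) (w : Equiv.Perm (Fin n)) :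
    leftMul q i f w = if w (lo i) < w (hi i) then (q : R) * f (w * simple i)
      else f (w * simple i) + ((q : R) - 1) * f w := rfl

theorem leftMul_comm (i j : Fin (n - 1)) (h : i.1 + 1 < j.1) (f : Equiv.Perm (Fin n) → R) :
    leftMul q i (leftMul q j f) = leftMul q j (leftMul q i f) := by
  have h1 : simple i (lo j) = lo j := simple_of_ne i
    (by simp [Fin.ext_iff]; omega) (by simp [Fin.ext_iff]; omega)
  have h2 : simple i (hi j) = hi j := simple_of_ne i
    (by simp [Fin.ext_iff]; omega) (by simp [Fin.ext_iff]; omega)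
  have h3 : simple j (lo i) = lo i := simple_of_ne j
    (by simp [Fin.ext_iff]; omega) (by simp [Fin.ext_iff]; omega)
  have h4 : simple j (hi i) = hi i := simple_of_ne j
    (by simp [Fin.ext_iff]; omega) (by simp [Fin.ext_iff]; omega)
  ext w
  simp only [leftMul_apply, Equiv.Perm.mul_apply, h1, h2, h3, h4]
  rw [mul_assoc, mul_assoc, simple_comm i j h]
  split_ifs <;> ring

theorem leftMul_braid (i j : Fin (n - 1)) (h : i.1 + 1 = j.1) (f : Equiv.Perm (Fin n) → R) :
    leftMul q i (leftMul q j (leftMul q i f)) = leftMul q j (leftMul q i (leftMul q j f)) := by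
  have e : lo j = hi i := Fin.ext h.symm
  have h1 : simple j (lo i) = lo i := simple_of_ne j
    (by simp [Fin.ext_iff]; omega) (by simp [Fin.ext_iff]; omega)
  have h2 : simple i (hi j) = hi j := simple_of_ne i
    (by simp [Fin.ext_iff]; omega) (by simp [Fin.ext_iff]; omega)
  have h3 : simple j (hi i) = hi j := by rw [← e, simple_lo]
  have h4 : simple j (hi j) = hi i := by rw [← e, simple_hi]
  ext w
  have hb : w * simple i * simple j * simple i = w * simple j * simple i * simple j := by
    simpa only [mul_assoc] using congrArg (w * ·) (simple_braid i j h)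
  have hne := apply_lo_ne_apply_hi w i
  have hne' := apply_lo_ne_apply_hi w j
  rw [e] at hne'
  simp only [leftMul_apply, Equiv.Perm.mul_apply, e, simple_lo, simple_hi, h1, h2, h3, h4, hb,
    mul_simple_mul_simple]
  -- Only the relative order of the values of `w` at three consecutive letters decides which
  -- branches of `leftMul` apply.
  rcases lt_or_gt_of_ne hne with a | a <;> rcases lt_or_gt_of_ne hne' with b | b
  · simp only [a, b, a.trans b, if_true]
  · rcases lt_or_ge (w (lo i)) (w (hi j)) with c | c <;>
      simp only [a, a.not_gt, b, b.not_gt, c, c.not_gt, if_true, if_false] <;> ring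
  · rcases lt_or_ge (w (lo i)) (w (hi j)) with c | c <;>
      simp only [a, a.not_gt, b, b.not_gt, c, c.not_gt, if_true, if_false] <;> ring
  · simp only [a, b, a.not_gt, b.not_gt, (b.trans a).not_gt, if_true, if_false]; ring

theorem leftMul_quad (i : Fin (n - 1)) (f : Equiv.Perm (Fin n) → R) :
    leftMul q i (leftMul q i f) = (q : R) • f + ((q : R) - 1) • leftMul q i f := by
  ext w
  rcases lt_or_gt_of_ne (apply_lo_ne_apply_hi w i) with a | a <;>
  · simp only [leftMul_apply, Equiv.Perm.mul_apply, simple_lo, simple_hi, a, a.not_gt, if_true,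
      if_false, mul_simple_mul_simple, Pi.add_apply, Pi.smul_apply, smul_eq_mul]
    try ring

/-- The regular representation of the Hecke algebra in coordinates. -/
noncomputable def regularRep : Hecke R q n →ₐ[R] Module.End R (Equiv.Perm (Fin n) → R) :=
  RingQuot.liftAlgHom R
    ⟨FreeAlgebra.lift R fun i ↦ leftMul q i, by
      intro x y h
      induction h with
      | comm i j h =>
        refine LinearMap.ext fun f ↦ ?_
        simpa using leftMul_comm q i j h f
      | braid i j h =>
        refine LinearMap.ext fun f ↦ ?_
        simpa using leftMul_braid q i j h f
      | quad i =>
        refine LinearMap.ext fun f ↦ ?_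
        simp only [map_mul, map_add, map_sub, map_one, map_zero, FreeAlgebra.lift_ι_apply,
          AlgHom.commutes, Module.End.mul_apply, LinearMap.add_apply, LinearMap.sub_apply,
          Module.algebraMap_end_apply, Module.End.one_apply, LinearMap.zero_apply,
          map_smul, leftMul_quad]
        module⟩

theorem regularRep_gen (i : Fin (n - 1)) : regularRep q (gen q i) = leftMul q i := by
  simp [regularRep, gen]

/-- The coefficient of `T_w` in an element of the Hecke algebra. -/
noncomputable def coeff (w : Equiv.Perm (Fin n)) : Hecke R q n →ₗ[R] R :=
  LinearMap.proj w ∘ₗ LinearMap.applyₗ (Pi.single 1 1) ∘ₗ (regularRep q).toLinearMap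

/-- Evaluating at the indicator of `1` recovers coordinates, which is what makes the `T_w` linearly
independent. -/
theorem regularRep_T (w : Equiv.Perm (Fin n)) :
    regularRep q (T q w) (Pi.single 1 1) = Pi.single w (1 : R) := by
  induction w using T_induction with
  | one => simp
  | step w i hi' ih =>
    rw [← gen_mul_T q hi', map_mul, Module.End.mul_apply, ih, regularRep_gen]
    ext v
    have hv : v * simple i = w ↔ v = w * simple i :=
      ⟨fun h ↦ by rw [← h, mul_simple_mul_simple], fun h ↦ by rw [h, mul_simple_mul_simple]⟩
    simp only [leftMul_apply, Pi.single_apply, hv]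
    by_cases h1 : v = w * simple i
    · have : v ≠ w := by
        rintro rfl
        have := length_mul_simple hi'
        rw [← h1] at this
        omega
      rw [if_neg this, if_pos h1, if_neg (by rw [h1]; simpa using hi'.le)]
      ring
    · rw [if_neg h1]
      by_cases h2 : v = w
      · rw [if_pos (by rwa [h2])]; ring
      · rw [if_neg h2]; simp

theorem coeff_T (v w : Equiv.Perm (Fin n)) :
    coeff q v (T q w) = if w = v then (1 : R) else 0 := by
  simp [coeff, regularRep_T, Pi.single_apply, eq_comm]

theorem T_mem_span (w : Equiv.Perm (Fin n)) :
    (T q w : Hecke R q n) ∈ Submodule.span R (Set.range (T q)) :=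
  Submodule.subset_span ⟨w, rfl⟩

theorem gen_mul_T_mem_span (i : Fin (n - 1)) (w : Equiv.Perm (Fin n)) :
    (gen q i * T q w : Hecke R q n) ∈
      Submodule.span R (T q '' {v | v = w * simple i ∨ (v = w ∧ w (hi i) < w (lo i))}) := by
  rcases lt_or_gt_of_ne (apply_lo_ne_apply_hi w i) with h | h
  · rw [gen_mul_T q h]
    exact Submodule.subset_span ⟨_, Or.inl rfl, rfl⟩
  · rw [gen_mul_T_of_gt q h]
    exact add_mem (Submodule.smul_mem _ _ (Submodule.subset_span ⟨_, Or.inl rfl, rfl⟩))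
      (Submodule.smul_mem _ _ (Submodule.subset_span ⟨_, Or.inr ⟨rfl, h⟩, rfl⟩))

/-- The elements `T_w` span the Hecke algebra. -/
theorem span_T : Submodule.span R (Set.range (T q)) = (⊤ : Submodule R (Hecke R q n)) := by
  have key : ∀ (x : Hecke R q n) (y : Hecke R q n), y ∈ Submodule.span R (Set.range (T q)) →
      x * y ∈ Submodule.span R (Set.range (T q)) := by
    intro x
    obtain ⟨x, rfl⟩ := RingQuot.mkAlgHom_surjective R (HeckeRel R q n) x
    induction x using FreeAlgebra.induction with
    | grade0 r =>
      intro y hy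
      rw [AlgHom.commutes, ← Algebra.smul_def]
      exact Submodule.smul_mem _ _ hy
    | grade1 i =>
      intro y hy
      induction hy using Submodule.span_induction with
      | mem y hy =>
        obtain ⟨w, rfl⟩ := hy
        exact Submodule.span_mono (Set.image_subset_range _ _) (gen_mul_T_mem_span q i w)
      | zero => simp
      | add y z _ _ hy hz => rw [mul_add]; exact add_mem hy hz
      | smul r y _ hy => rw [mul_smul_comm]; exact Submodule.smul_mem _ _ hy
    | mul a b ha hb => intro y hy; rw [map_mul, mul_assoc]; exact ha _ (hb _ hy)
    | add a b ha hb => intro y hy; rw [map_add, add_mul]; exact add_mem (ha _ hy) (hb _ hy)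
  rw [eq_top_iff]
  intro x _
  simpa using key x 1 (by simpa using T_mem_span q 1)

theorem T_induction_span {P : Hecke R q n → Prop} (T_mem : ∀ w, P (T q w)) (zero : P 0)
    (add : ∀ x y, P x → P y → P (x + y)) (smul : ∀ (r : R) x, P x → P (r • x))
    (x : Hecke R q n) : P x := by
  have hx : x ∈ Submodule.span R (Set.range (T q)) := by rw [span_T]; trivial
  induction hx using Submodule.span_induction with
  | mem y hy => obtain ⟨w, rfl⟩ := hy; exact T_mem w
  | zero => exact zero
  | add y z _ _ hy hz => exact add _ _ hy hz
  | smul r y _ hy => exact smul _ _ hy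

theorem anti_anti (x : Hecke R q n) : anti q (anti q x) = x := by
  induction x using T_induction_span with
  | T_mem w => simp [anti_T]
  | zero => simp
  | add x y hx hy => simp [hx, hy]
  | smul r x hx => simp [hx]

/-- `T_u T_v` is a combination of `T_{uv}` and of elements `T_w` with `ℓ(w) < ℓ(u) + ℓ(v)`. -/
theorem T_mul_T_mem_span (u v : Equiv.Perm (Fin n)) :
    (T q u * T q v : Hecke R q n) ∈ Submodule.span R
      (T q '' {w | w = v * u ∨ length w < length u + length v}) := by
  induction u using T_induction with
  | one => exact Submodule.subset_span ⟨v, Or.inl rfl, by simp⟩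
  | step u i hi' ih =>
    rw [← gen_mul_T q hi', mul_assoc, length_mul_simple hi', ← mul_assoc]
    generalize (T q u * T q v : Hecke R q n) = x at ih
    induction ih using Submodule.span_induction with
    | mem y hy =>
      obtain ⟨w, hw, rfl⟩ := hy
      refine Submodule.span_mono (Set.image_mono ?_) (gen_mul_T_mem_span q i w)
      have hle : length (v * u) ≤ length u + length v := length_mul_le v u
      have hs : length (w * simple i) ≤ length w + 1 := by
        rcases lt_or_gt_of_ne (apply_lo_ne_apply_hi w i) with h | h
        · exact (length_mul_simple h).le
        · have := length_mul_simple_of_gt h; omega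
      rintro x (rfl | ⟨rfl, -⟩)
      · rcases hw with rfl | hw
        · exact Or.inl rfl
        · exact Or.inr (by omega)
      · rcases hw with rfl | hw
        · exact Or.inr (by omega)
        · exact Or.inr (by omega)
    | zero => simp
    | add y z _ _ hy hz => rw [mul_add]; exact add_mem hy hz
    | smul r y _ hy => rw [mul_smul_comm]; exact Submodule.smul_mem _ _ hy

/-- The elements `T_w` are invertible. -/
theorem isUnit_T (w : Equiv.Perm (Fin n)) : IsUnit (T q w : Hecke R q n) := by
  induction w using T_induction with
  | one => simp
  | step w i hi' ih =>
    rw [← gen_mul_T q hi']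
    refine IsUnit.mul ?_ ih
    have h := gen_mul_self (R := R) q i
    have e : ((q : R) - 1) • gen q i + (q : R) • 1 + (1 - (q : R)) • gen q i =
        (q : R) • (1 : Hecke R q n) := by module
    -- The quadratic relation reads `T_i (T_i + 1 - q) = q`, with `q` invertible.
    refine isUnit_iff_exists.2 ⟨(↑q⁻¹ : R) • (gen q i + (1 - (q : R)) • 1), ?_, ?_⟩
    · rw [mul_smul_comm, mul_add, h, mul_smul_comm, mul_one, e, smul_smul, Units.inv_mul, one_smul]
    · rw [smul_mul_assoc, add_mul, h, smul_mul_assoc, one_mul, e, smul_smul, Units.inv_mul, one_smul]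

end Multiplication

/-! ### Parabolic subgroups

A monotone function `f : Fin n → ℕ` cuts the letters into consecutive blocks. -/

section Parabolic

variable {n : ℕ}

/-- The permutations that preserve the labels `f`. -/
def stab (f : Fin n → ℕ) : Subgroup (Equiv.Perm (Fin n)) where
  carrier := {w | ∀ i, f (w i) = f i}
  mul_mem' {v w} hv hw i := by simp [hv (w i), hw i]
  one_mem' i := rfl
  inv_mem' {w} hw i := by simpa using (hw (w⁻¹ i)).symm

theorem mem_stab {f : Fin n → ℕ} {w : Equiv.Perm (Fin n)} :
    w ∈ stab f ↔ ∀ i, f (w i) = f i := Iff.rfl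

/-- The permutation `w` increases on each block of `f`. -/
def IncrOn (f : Fin n → ℕ) (w : Equiv.Perm (Fin n)) : Prop :=
  ∀ i j, i < j → f i = f j → w i < w j

theorem simple_mem_stab {f : Fin n → ℕ} {i : Fin (n - 1)} (h : f (lo i) = f (hi i)) :
    simple i ∈ stab f := by
  intro x
  by_cases h1 : x = lo i
  · rw [h1, simple_lo, h]
  by_cases h2 : x = hi i
  · rw [h2, simple_hi, h]
  rw [simple_of_ne i h1 h2]

theorem stab_le_stab {f g : Fin n → ℕ} (h : ∀ i j, f i = f j → g i = g j) : stab f ≤ stab g :=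
  fun _ hw i ↦ h _ _ (hw i)

theorem incrOn_of_forall_lo_lt_hi {f : Fin n → ℕ} (hf : Monotone f) {w : Equiv.Perm (Fin n)}
    (h : ∀ i : Fin (n - 1), f (lo i) = f (hi i) → ¬ w (hi i) < w (lo i)) : IncrOn f w :=
  fun _ _ hij hfij ↦ lt_of_forall_lo_lt_hi hf (fun k hk ↦
    (not_lt.1 (h k hk)).lt_of_ne (apply_lo_ne_apply_hi w k)) hij hfij

theorem exists_mul_incrOn {f : Fin n → ℕ} (hf : Monotone f) (w : Equiv.Perm (Fin n)) :
    ∃ v ∈ stab f, IncrOn f (w * v) := by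
  induction hk : length w using Nat.strong_induction_on generalizing w with
  | _ k ih =>
    by_cases h : ∃ i : Fin (n - 1), f (lo i) = f (hi i) ∧ w (hi i) < w (lo i)
    · obtain ⟨i, hfi, hwi⟩ := h
      have := length_mul_simple_of_gt hwi
      obtain ⟨v, hv, hv'⟩ := ih _ (by omega) (w * simple i) rfl
      exact ⟨simple i * v, mul_mem (simple_mem_stab hfi) hv, by rwa [← mul_assoc]⟩
    · push Not at h
      exact ⟨1, one_mem _, incrOn_of_forall_lo_lt_hi hf fun i hi' ↦ by simpa using h i hi'⟩

/-- Uniqueness of the increasing representative of a coset: an inversion of `v` stays inside a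
block, where `d` and `d * v` would order it in opposite ways. -/
theorem eq_one_of_incrOn {f : Fin n → ℕ} (hf : Monotone f) {d v : Equiv.Perm (Fin n)}
    (hd : IncrOn f d) (hdv : IncrOn f (d * v)) (hv : v ∈ stab f) : v = 1 := by
  refine eq_one_of_lt fun i j hij ↦ ?_
  by_contra hc
  have hlt : v j < v i := (not_lt.1 hc).lt_of_ne fun e ↦ hij.ne' (v.injective e)
  have h1 := hf hlt.le
  rw [hv, hv] at h1
  have h2 : f i = f j := le_antisymm (hf hij.le) h1
  exact (hd _ _ hlt (by rw [hv, hv, h2])).not_gt (hdv i j hij h2)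

theorem length_mul_of_incrOn {f : Fin n → ℕ} (hf : Monotone f) {v d : Equiv.Perm (Fin n)}
    (hv : v ∈ stab f) (hd : IncrOn f d) : length (d * v) = length v + length d :=
  length_mul_of_forall fun i j hij hlt ↦ hd _ _ hlt (by
    have := hf hlt.le
    have h2 := hf hij.le
    rw [hv, hv] at *
    omega)

/-- Lengths add for an increasing representative, while a descent inside a block could be removed
within the coset. -/
theorem incrOn_iff_length_le {f : Fin n → ℕ} (hf : Monotone f) {d : Equiv.Perm (Fin n)} :
    IncrOn f d ↔ ∀ v ∈ stab f, length d ≤ length (d * v) := by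
  refine ⟨fun h v hv ↦ by rw [length_mul_of_incrOn hf hv h]; omega, fun h ↦ ?_⟩
  refine incrOn_of_forall_lo_lt_hi hf fun i hfi hdi ↦ ?_
  have h1 := h _ (simple_mem_stab hfi)
  have h2 := length_mul_simple_of_gt hdi
  omega

/-! ### Plain and signed sums over parabolic subgroups. -/

variable {R : Type u} [CommRing R] (q : Rˣ)

theorem T_mul_T_of_incrOn {f : Fin n → ℕ} (hf : Monotone f) {v d : Equiv.Perm (Fin n)}
    (hv : v ∈ stab f) (hd : IncrOn f d) : (T q v * T q d : Hecke R q n) = T q (d * v) :=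
  T_mul_T q fun i j hij hlt ↦ hd _ _ hlt (by
    have := hf hlt.le
    have h2 := hf hij.le
    rw [hv, hv] at *
    omega)

open scoped Classical in
/-- The sum of the `T_w` over the parabolic subgroup of `f`. -/
noncomputable def symSum (f : Fin n → ℕ) : Hecke R q n :=
  ∑ w : Equiv.Perm (Fin n) with w ∈ stab f, T q w

open scoped Classical in
/-- The sum of the `T_w` over the minimal length right coset representatives of the parabolic
subgroup of `f` in that of `g`. -/
noncomputable def repSum (f g : Fin n → ℕ) : Hecke R q n :=
  ∑ w : Equiv.Perm (Fin n) with w ∈ stab g ∧ IncrOn f w, T q w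

/-- Each element of the larger subgroup factors uniquely through the smaller one and an increasing
representative, with lengths adding up. -/
theorem symSum_eq_mul_repSum {f g : Fin n → ℕ} (hf : Monotone f)
    (h : ∀ i j, f i = f j → g i = g j) :
    (symSum q g : Hecke R q n) = symSum q f * repSum q f g := by
  classical
  rw [symSum, symSum, repSum, Finset.sum_mul_sum, ← Finset.sum_product']
  symm
  refine Finset.sum_bij (fun p _ ↦ p.2 * p.1) ?_ ?_ ?_ ?_
  · rintro ⟨v, d⟩ hp
    simp only [Finset.mem_product, Finset.mem_filter, Finset.mem_univ, true_and] at hp ⊢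
    exact mul_mem hp.2.1 (stab_le_stab h hp.1)
  · rintro ⟨v, d⟩ hp ⟨v', d'⟩ hp' e
    simp only [Finset.mem_product, Finset.mem_filter, Finset.mem_univ, true_and] at hp hp' e
    have e' : d' = d * (v * v'⁻¹) := by rw [← mul_assoc, e, mul_inv_cancel_right]
    have h1 := eq_one_of_incrOn hf hp.2.2 (e' ▸ hp'.2.2) (mul_mem hp.1 (inv_mem hp'.1))
    rw [h1, mul_one] at e'
    rw [mul_inv_eq_one.1 h1, e']
  · intro w hw
    simp only [Finset.mem_filter, Finset.mem_univ, true_and] at hw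
    obtain ⟨v, hv, hwv⟩ := exists_mul_incrOn hf w
    refine ⟨(v⁻¹, w * v), ?_, by simp⟩
    simp only [Finset.mem_product, Finset.mem_filter, Finset.mem_univ, true_and]
    exact ⟨inv_mem hv, mul_mem hw (stab_le_stab h hv), hwv⟩
  · rintro ⟨v, d⟩ hp
    simp only [Finset.mem_product, Finset.mem_filter, Finset.mem_univ, true_and] at hp
    exact T_mul_T_of_incrOn q hf hp.1 hp.2.2

theorem anti_symSum (f : Fin n → ℕ) : anti q (symSum q f : Hecke R q n) = symSum q f := by
  classical
  rw [symSum, anti_sum]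
  refine Finset.sum_bij (fun w _ ↦ w⁻¹) ?_ ?_ ?_ ?_
  · intro w hw; simpa using hw
  · intro v _ w _ h; exact inv_injective h
  · intro w hw; exact ⟨w⁻¹, by simpa using hw, by simp⟩
  · intro w _; exact anti_T q w

/-- The subgroup splits into pairs `w`, `w * simple i`; the factor `y` collects the shorter members.
-/
theorem exists_symSum_eq_mul (f : Fin n → ℕ) {i : Fin (n - 1)} (h : f (lo i) = f (hi i)) :
    ∃ y : Hecke R q n, symSum q f = (1 + gen q i) * y := by
  classical
  refine ⟨∑ w : Equiv.Perm (Fin n) with w ∈ stab f ∧ w (lo i) < w (hi i), T q w, ?_⟩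
  rw [symSum, add_mul, one_mul, ← Finset.sum_filter_add_sum_filter_not _
    (fun w : Equiv.Perm (Fin n) ↦ w (lo i) < w (hi i)), Finset.filter_filter,
    Finset.filter_filter, Finset.mul_sum]
  congr 1
  refine Finset.sum_bij (fun w _ ↦ w * simple i) ?_ ?_ ?_ ?_
  · intro w hw
    simp only [Finset.mem_filter, Finset.mem_univ, true_and] at hw ⊢
    refine ⟨mul_mem hw.1 (simple_mem_stab h), ?_⟩
    simpa using (not_lt.1 hw.2).lt_of_ne (apply_lo_ne_apply_hi w i).symm
  · intro v _ w _ e; exact mul_right_cancel e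
  · intro w hw
    simp only [Finset.mem_filter, Finset.mem_univ, true_and] at hw
    refine ⟨w * simple i, ?_, by simp⟩
    simp only [Finset.mem_filter, Finset.mem_univ, true_and]
    exact ⟨mul_mem hw.1 (simple_mem_stab h), by simpa using hw.2.le⟩
  · intro w hw
    simp only [Finset.mem_filter, Finset.mem_univ, true_and] at hw
    rw [gen_mul_T q, mul_simple_mul_simple]
    simpa using (not_lt.1 hw.2).lt_of_ne (apply_lo_ne_apply_hi w i).symm

theorem exists_symSum_eq_mul' (f : Fin n → ℕ) {i : Fin (n - 1)} (h : f (lo i) = f (hi i)) :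
    ∃ y : Hecke R q n, symSum q f = y * (1 + gen q i) := by
  obtain ⟨y, hy⟩ := exists_symSum_eq_mul (R := R) q f h
  refine ⟨anti q y, ?_⟩
  rw [← anti_symSum, hy]
  simp [anti_gen]

theorem symSum_mul_gen (f : Fin n → ℕ) {i : Fin (n - 1)} (h : f (lo i) = f (hi i)) :
    (symSum q f * gen q i : Hecke R q n) = (q : R) • symSum q f := by
  obtain ⟨y, hy⟩ := exists_symSum_eq_mul' (R := R) q f h
  have : ((1 + gen q i) * gen q i : Hecke R q n) = (q : R) • (1 + gen q i) := by
    rw [add_mul, one_mul, gen_mul_self]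
    module
  rw [hy, mul_assoc, this, mul_smul_comm]

theorem symSum_mul_T {f : Fin n → ℕ} (hf : Monotone f) {v : Equiv.Perm (Fin n)} (hv : v ∈ stab f) :
    (symSum q f * T q v : Hecke R q n) = (q : R) ^ length v • symSum q f := by
  induction v using T_induction with
  | one => simp
  | step v i hvi ih =>
    -- Membership of `v * simple i` gives `f (hi i) = f (v (lo i)) ≤ f (v (hi i)) = f (lo i)`.
    have hfi : f (lo i) = f (hi i) := by
      refine le_antisymm (hf (lo_lt_hi i).le) ?_
      have h1 := hf hvi.le
      have h2 := hv (lo i)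
      have h3 := hv (hi i)
      simp only [Equiv.Perm.mul_apply, simple_lo, simple_hi] at h2 h3
      omega
    have hv' : v ∈ stab f := by
      simpa using mul_mem hv (simple_mem_stab hfi)
    rw [← gen_mul_T q hvi, ← mul_assoc, symSum_mul_gen q f hfi, smul_mul_assoc, ih hv', smul_smul,
      length_mul_simple hvi, pow_succ']

open scoped Classical in
/-- The signed sum of the `T_w` over the parabolic subgroup of `f`. -/
noncomputable def altSum (f : Fin n → ℕ) : Hecke R q n :=
  ∑ w : Equiv.Perm (Fin n) with w ∈ stab f, (-(↑q⁻¹ : R)) ^ length w • T q w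

/-- Pairing `w` with `w * simple i` extracts a left factor `1 - q⁻¹ T_i`, and `(1 + T_i)(1 - q⁻¹
T_i) = 0` is the quadratic relation. This dictates the weights `(-q⁻¹)^ℓ(w)`. -/
theorem one_add_gen_mul_altSum (f : Fin n → ℕ) {i : Fin (n - 1)} (h : f (lo i) = f (hi i)) :
    ((1 + gen q i) * altSum q f : Hecke R q n) = 0 := by
  classical
  have key : (altSum q f : Hecke R q n) = (1 + (-(↑q⁻¹ : R)) • gen q i) *
      ∑ w : Equiv.Perm (Fin n) with w ∈ stab f ∧ w (lo i) < w (hi i),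
        (-(↑q⁻¹ : R)) ^ length w • T q w := by
    rw [altSum, add_mul, one_mul, ← Finset.sum_filter_add_sum_filter_not _
      (fun w : Equiv.Perm (Fin n) ↦ w (lo i) < w (hi i)), Finset.filter_filter,
      Finset.filter_filter, Finset.mul_sum]
    congr 1
    refine Finset.sum_bij (fun w _ ↦ w * simple i) ?_ ?_ ?_ ?_
    · intro w hw
      simp only [Finset.mem_filter, Finset.mem_univ, true_and] at hw ⊢
      refine ⟨mul_mem hw.1 (simple_mem_stab h), ?_⟩
      simpa using (not_lt.1 hw.2).lt_of_ne (apply_lo_ne_apply_hi w i).symm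
    · intro v _ w _ e; exact mul_right_cancel e
    · intro w hw
      simp only [Finset.mem_filter, Finset.mem_univ, true_and] at hw
      refine ⟨w * simple i, ?_, by simp⟩
      simp only [Finset.mem_filter, Finset.mem_univ, true_and]
      exact ⟨mul_mem hw.1 (simple_mem_stab h), by simpa using hw.2.le⟩
    · intro w hw
      simp only [Finset.mem_filter, Finset.mem_univ, true_and] at hw
      have hlt : w (hi i) < w (lo i) := (not_lt.1 hw.2).lt_of_ne (apply_lo_ne_apply_hi w i).symm
      rw [smul_mul_smul_comm, gen_mul_T q (by simpa using hlt), mul_simple_mul_simple,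
        length_mul_simple_of_gt hlt, pow_succ']
  have hz : ((1 + gen q i) * (1 + (-(↑q⁻¹ : R)) • gen q i) : Hecke R q n) = 0 := by
    rw [mul_add, mul_one, mul_smul_comm, add_mul, one_mul, gen_mul_self]
    have hq : (↑q⁻¹ : R) * (q : R) = 1 := by simp
    simp only [smul_add, smul_smul, neg_mul, mul_sub, hq, mul_one]
    module
  rw [key, ← mul_assoc, hz, zero_mul]

theorem gen_mul_altSum (f : Fin n → ℕ) {i : Fin (n - 1)} (h : f (lo i) = f (hi i)) :
    (gen q i * altSum q f : Hecke R q n) = (-1 : R) • altSum q f := by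
  have := one_add_gen_mul_altSum (R := R) q f h
  rw [add_mul, one_mul] at this
  rw [eq_neg_of_add_eq_zero_right this]
  module

/-- `m_f T_w n_g` vanishes if `w` maps two letters of the same block of `f` into the same block
of `g`. -/
theorem symSum_mul_T_mul_altSum_eq_zero {f g : Fin n → ℕ} (hf : Monotone f) (hg : Monotone g)
    (w : Equiv.Perm (Fin n)) {a b : Fin n} (hab : a ≠ b) (hfab : f a = f b)
    (hgab : g (w a) = g (w b)) : (symSum q f * T q w * altSum q g : Hecke R q n) = 0 := by
  induction hk : length w using Nat.strong_induction_on generalizing w a b with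
  | _ k ih =>
  -- Descents of `w` inside blocks of `f` are absorbed by `m_f`, and descents of `w⁻¹` inside blocks
  -- of `g` by `n_g`, each up to a scalar; so `w` may be assumed to have neither.
  by_cases h1 : ∃ i : Fin (n - 1), f (lo i) = f (hi i) ∧ w (hi i) < w (lo i)
  · obtain ⟨i, hfi, hwi⟩ := h1
    have hl := length_mul_simple_of_gt hwi
    have := ih _ (by omega) (w * simple i) (a := simple i a) (b := simple i b)
      (fun e ↦ hab ((simple i).injective e)) (by
        rw [simple_mem_stab hfi, simple_mem_stab hfi, hfab]) (by simpa using hgab) rfl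
    have e := gen_mul_T (R := R) q (w := w * simple i) (i := i) (by simpa using hwi)
    rw [mul_simple_mul_simple] at e
    rw [← e, ← mul_assoc, symSum_mul_gen q f hfi, smul_mul_assoc, smul_mul_assoc, this, smul_zero]
  by_cases h2 : ∃ i : Fin (n - 1), g (lo i) = g (hi i) ∧ w⁻¹ (hi i) < w⁻¹ (lo i)
  · obtain ⟨i, hgi, hwi⟩ := h2
    have hl := length_simple_mul_of_gt hwi
    have := ih _ (by omega) (simple i * w) hab hfab (by
        simp only [Equiv.Perm.mul_apply]
        rw [simple_mem_stab hgi, simple_mem_stab hgi, hgab]) rfl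
    have e := T_mul_gen (R := R) q (w := simple i * w) (i := i) (by simpa using hwi)
    rw [simple_mul_simple_mul] at e
    rw [← e, mul_assoc, mul_assoc, gen_mul_altSum q g hgi, mul_smul_comm, mul_smul_comm,
      ← mul_assoc, this, smul_zero]
  push Not at h1 h2
  have hwf : IncrOn f w := incrOn_of_forall_lo_lt_hi hf fun i h ↦ (h1 i h).not_gt
  have hwg : IncrOn g w⁻¹ := incrOn_of_forall_lo_lt_hi hg fun i h ↦ (h2 i h).not_gt
  clear ih h1 h2
  wlog hlt : a < b generalizing a b
  · exact this hab.symm hfab.symm hgab.symm ((not_lt.1 hlt).lt_of_ne hab.symm)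
  have hlt' := Fin.lt_def.1 hlt
  set i : Fin (n - 1) := ⟨a.1, by omega⟩ with hi_def
  have ha : a = lo i := rfl
  have hle : hi i ≤ b := by rw [Fin.le_def]; simpa [i] using hlt'
  have hfi : f (lo i) = f (hi i) :=
    le_antisymm (hf (lo_lt_hi i).le) ((hf hle).trans (hfab ▸ le_refl _))
  have hwi : w (lo i) < w (hi i) := hwf _ _ (lo_lt_hi i) hfi
  have hwb : w (hi i) ≤ w b := by
    rcases hle.eq_or_lt with h | h
    · rw [h]
    · exact (hwf _ _ h (by rw [← hfi, ← ha, hfab])).le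
  have hgi : g (w (lo i)) = g (w (hi i)) :=
    le_antisymm (hg hwi.le) ((hg hwb).trans (hgab ▸ le_refl _))
  -- A letter strictly between the two images would lie in their block of `g`, so its preimage would
  -- lie strictly between two neighbours.
  have hadj : (w (hi i)).1 = (w (lo i)).1 + 1 := by
    by_contra hc
    have hwi' := Fin.lt_def.1 hwi
    obtain ⟨m, hm⟩ : ∃ m : Fin n, m.1 = (w (lo i)).1 + 1 := ⟨⟨_, by omega⟩, rfl⟩
    have l1 : w (lo i) < m := by rw [Fin.lt_def]; omega
    have l2 : m < w (hi i) := by rw [Fin.lt_def]; omega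
    have g1 := hg l1.le
    have g2 := hg l2.le
    have c1 := hwg _ _ l1 (by omega)
    have c2 := hwg _ _ l2 (by omega)
    simp only [Equiv.Perm.inv_def, Equiv.symm_apply_apply] at c1 c2
    rw [Fin.lt_def] at c1 c2
    simp only [lo_val, hi_val] at c1 c2
    omega
  set k : Fin (n - 1) := ⟨(w (lo i)).1, by omega⟩ with hk_def
  have hk1 : w (lo i) = lo k := rfl
  have hk2 : w (hi i) = hi k := Fin.ext hadj
  -- Since `w` takes neighbours to neighbours in order, the right factor `1 + T_i` of `m_f` passes
  -- through `T_w` as `1 + T_k`, which kills `n_g`.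
  have hcomm : w * simple i = simple k * w := by
    rw [← mul_inv_eq_iff_eq_mul, show simple i = Equiv.swap (lo i) (hi i) from rfl,
      ← Equiv.swap_apply_apply, hk1, hk2]
    rfl
  have e : (gen q i * T q w : Hecke R q n) = T q w * gen q k := by
    rw [gen_mul_T q hwi, hcomm, T_mul_gen]
    rw [← hk1, ← hk2]
    simpa using lo_lt_hi i
  obtain ⟨y, hy⟩ := exists_symSum_eq_mul' (R := R) q f hfi
  have e' : ((1 + gen q i) * T q w : Hecke R q n) = T q w * (1 + gen q k) := by
    rw [add_mul, e, mul_add, one_mul, mul_one]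
  rw [hy, mul_assoc y, e', mul_assoc, mul_assoc, one_add_gen_mul_altSum q g (by
    rw [← hk1, ← hk2, hgi]), mul_zero, mul_zero]

/-- Conjugation by `x` matches the two subgroups, and because `x` increases on blocks, lengths add
on both sides of the identity. -/
theorem symSum_mul_T_eq_T_mul_symSum {f g : Fin n → ℕ} (hf : Monotone f) (hg : Monotone g)
    {x : Equiv.Perm (Fin n)} (hx : IncrOn f x) (hfg : ∀ i j, f i = f j ↔ g (x i) = g (x j)) :
    (symSum q f * T q x : Hecke R q n) = T q x * symSum q g := by
  classical
  rw [symSum, symSum, Finset.sum_mul, Finset.mul_sum]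
  refine Finset.sum_bij (fun v _ ↦ x * v * x⁻¹) ?_ ?_ ?_ ?_
  · intro v hv
    simp only [Finset.mem_filter, Finset.mem_univ, true_and] at hv ⊢
    intro i
    simpa using (hfg _ _).1 (hv (x⁻¹ i))
  · intro v _ w _ e
    simpa using e
  · intro w hw
    simp only [Finset.mem_filter, Finset.mem_univ, true_and] at hw
    refine ⟨x⁻¹ * w * x, ?_, by simp [mul_assoc]⟩
    simp only [Finset.mem_filter, Finset.mem_univ, true_and]
    intro i
    rw [hfg]
    simpa using hw (x i)
  · intro v hv
    simp only [Finset.mem_filter, Finset.mem_univ, true_and] at hv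
    have hv' : ∀ i, g (x (v i)) = g (x i) := fun i ↦ (hfg _ _).1 (hv i)
    rw [T_mul_T_of_incrOn q hf hv hx, T_mul_T, mul_assoc, inv_mul_cancel, mul_one]
    intro i j hij hlt
    simp only [Equiv.Perm.mul_apply, Equiv.Perm.inv_def, Equiv.symm_apply_apply]
    by_contra hc
    have hlt' : x (v i) < x (v j) := (not_lt.1 hc).lt_of_ne fun e ↦
      hij.ne (v.injective (x.injective e))
    have h1 := hg hlt'.le
    have h2 := hg hlt.le
    rw [hv', hv'] at h1
    exact hlt.not_gt (hx _ _ hij ((hfg _ _).2 (le_antisymm h1 h2)))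

end Parabolic

/-! ### Coset representatives for two adjacent blocks -/

section TwoBlocks

variable {n : ℕ}

/-- Permutations of the letters `p, …, p + a + c - 1` that increase on the first `a` and on the
last `c` of these letters. -/
structure IsShuffle (p a c : ℕ) (w : Equiv.Perm (Fin n)) : Prop where
  fix : ∀ i : Fin n, i.1 < p ∨ p + a + c ≤ i.1 → w i = i
  incr_left : ∀ i j : Fin n, p ≤ i.1 → i < j → j.1 < p + a → w i < w j
  incr_right : ∀ i j : Fin n, p + a ≤ i.1 → i < j → j.1 < p + a + c → w i < w j

theorem le_apply_of_forall_fix {p : ℕ} {w : Equiv.Perm (Fin n)} (h : ∀ i : Fin n, i.1 < p → w i = i)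
    {k : Fin n} (hk : p ≤ k.1) : p ≤ (w k).1 := by
  by_contra hc
  have := w.injective (h (w k) (by omega))
  rw [this] at hc
  exact hc hk

theorem apply_lt_of_forall_fix {p : ℕ} {w : Equiv.Perm (Fin n)} (h : ∀ i : Fin n, p ≤ i.1 → w i = i)
    {k : Fin n} (hk : k.1 < p) : (w k).1 < p := by
  by_contra hc
  have := w.injective (h (w k) (by omega))
  rw [this] at hc
  exact hc hk

theorem IsShuffle.le_apply {p a c : ℕ} {w : Equiv.Perm (Fin n)} (h : IsShuffle p a c w)
    {k : Fin n} (hk : p ≤ k.1) : p ≤ (w k).1 :=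
  le_apply_of_forall_fix (fun i hi ↦ h.fix i (Or.inl hi)) hk

theorem IsShuffle.apply_lt {p a c : ℕ} {w : Equiv.Perm (Fin n)} (h : IsShuffle p a c w)
    {k : Fin n} (hk : k.1 < p + a + c) : (w k).1 < p + a + c :=
  apply_lt_of_forall_fix (fun i hi ↦ h.fix i (Or.inr hi)) hk

/-- The inversions of a shuffle are pairs of letters from different blocks. -/
theorem IsShuffle.mem_of_inversion {p a c : ℕ} {w : Equiv.Perm (Fin n)} (h : IsShuffle p a c w)
    {i j : Fin n} (hij : i < j) (hw : w j < w i) :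
    p ≤ i.1 ∧ i.1 < p + a ∧ p + a ≤ j.1 ∧ j.1 < p + a + c := by
  have hij' := Fin.lt_def.1 hij
  have hw' := Fin.lt_def.1 hw
  have h1 : p ≤ i.1 := by
    by_contra hc
    have e := h.fix i (Or.inl (by omega))
    rcases lt_or_ge j.1 p with hj | hj
    · rw [e, h.fix j (Or.inl hj)] at hw; omega
    · have := h.le_apply hj; rw [e] at hw'; omega
  have h2 : j.1 < p + a + c := by
    by_contra hc
    have e := h.fix j (Or.inr (by omega))
    rcases lt_or_ge i.1 (p + a + c) with hj | hj
    · have := h.apply_lt hj; rw [e] at hw'; omega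
    · rw [e, h.fix i (Or.inr hj)] at hw; omega
  refine ⟨h1, ?_, ?_, h2⟩
  · by_contra hc
    exact hw.not_gt (h.incr_right i j (by omega) hij h2)
  · by_contra hc
    exact hw.not_gt (h.incr_left i j h1 hij (by omega))

theorem mem_cosetReps_iff {p a c : ℕ} {w : Equiv.Perm (Fin n)} :
    w ∈ cosetReps n p [a, c] ↔ IsShuffle p a c w := by
  -- Each letter outside the two blocks gets a label of its own, so that the stabilizer of `f` fixes
  -- it.
  set f : Fin n → ℕ := fun i ↦ if i.1 < p then i.1 else if i.1 < p + a then p else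
    if i.1 < p + a + c then p + a else i.1 with hf_def
  have hf : Monotone f := by
    intro i j hij
    rw [Fin.le_def] at hij
    simp only [f]
    split_ifs <;> omega
  have hmem : ∀ v : Equiv.Perm (Fin n), v ∈ blockStabilizer n p [a, c] ↔ v ∈ stab f := by
    intro v
    simp only [blockStabilizer, symOn, Set.mem_ofPred_eq, mem_stab]
    constructor
    · rintro ⟨h1, h2⟩ i
      have h3 := h2 0 i
      have h4 := h2 1 i
      have h5 := h1 i
      simp only [List.take_zero, List.sum_nil, List.sum_cons, add_zero, zero_add, List.take_succ_cons,
        not_and, not_lt, Nat.reduceAdd] at h3 h4 h5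
      by_cases h6 : p ≤ i.1 → p + (a + c) ≤ i.1
      · rw [h5 h6]
      · simp only [f]
        split_ifs <;> omega
    · intro h
      refine ⟨fun i hi' ↦ Fin.ext ?_, fun k i h1 h2 ↦ ?_⟩
      · have := h i
        simp only [f, List.sum_cons, List.sum_nil] at this hi'
        split_ifs at this <;> omega
      · have := h i
        rcases k with _ | _ | k
        · simp only [List.take_zero, List.sum_nil, List.sum_cons, add_zero, zero_add,
            List.take_succ_cons, f] at *
          split_ifs at this <;> omega
        · simp only [List.take_zero, List.sum_nil, List.sum_cons, add_zero, zero_add,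
            List.take_succ_cons, f] at *
          split_ifs at this <;> omega
        · simp at h1 h2
          omega
  simp only [cosetReps, Set.mem_ofPred_eq, hmem, ← incrOn_iff_length_le hf]
  simp only [symOn, Set.mem_ofPred_eq, List.sum_cons, List.sum_nil, not_and, not_lt, add_zero]
  constructor
  · rintro ⟨h1, h2⟩
    refine ⟨fun i hi' ↦ h1 i (by omega), fun i j hi' hij hj ↦ h2 i j hij ?_,
      fun i j hi' hij hj ↦ h2 i j hij ?_⟩ <;>
    · rw [Fin.lt_def] at hij
      simp only [f]
      split_ifs <;> omega
  · intro h
    refine ⟨fun i hi' ↦ h.fix i (by omega), fun i j hij hfij ↦ ?_⟩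
    by_contra hc
    have hlt : w j < w i := (not_lt.1 hc).lt_of_ne fun e ↦ hij.ne' (w.injective e)
    have := h.mem_of_inversion hij hlt
    simp only [f] at hfij
    split_ifs at hfij <;> omega

/-! ### Recursions for sums over shuffles. -/

variable {R : Type u} [CommRing R] (q : Rˣ)

open scoped Classical in
/-- The sum of the `T_w` over the shuffles `w`. -/
noncomputable def shuffleSum (p a c : ℕ) : Hecke R q n :=
  ∑ w : Equiv.Perm (Fin n) with IsShuffle p a c w, T q w

theorem cosetSum_eq_shuffleSum (p a c : ℕ) :
    (cosetSum q p [a, c] : Hecke R q n) = shuffleSum q p a c := by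
  classical
  rw [cosetSum, shuffleSum]
  exact Finset.sum_congr (Finset.filter_congr fun w _ ↦ mem_cosetReps_iff) fun _ _ ↦ rfl

/-- The cycle moving the letter `p + k` to `p` and each of `p, …, p + k - 1` up by one. -/
def IsCyc (p k : ℕ) (x : Equiv.Perm (Fin n)) : Prop :=
  ∀ i, (x i).1 = if p ≤ i.1 ∧ i.1 < p + k then i.1 + 1 else if i.1 = p + k then p else i.1

theorem exists_isCyc {p k : ℕ} (h : p + k < n) : ∃ x : Equiv.Perm (Fin n), IsCyc p k x := by
  have : NeZero n := ⟨by omega⟩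
  have hle : (⟨p, by omega⟩ : Fin n) ≤ ⟨p + k, h⟩ := by rw [Fin.le_def]; simp
  refine ⟨Fin.cycleIcc ⟨p, by omega⟩ ⟨p + k, h⟩, fun i ↦ ?_⟩
  split_ifs with h1 h2
  · rw [Fin.cycleIcc_of_ge_of_lt (by rw [Fin.le_def]; exact h1.1) (by rw [Fin.lt_def]; exact h1.2),
      Fin.val_add_one_of_lt' (by omega)]
  · rw [show i = ⟨p + k, h⟩ from Fin.ext h2, Fin.cycleIcc_of_last hle]
  · rcases lt_or_ge i.1 p with h3 | h3
    · rw [Fin.cycleIcc_of_lt (by rw [Fin.lt_def]; exact h3)]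
    · rw [Fin.cycleIcc_of_gt (by rw [Fin.lt_def]; simp only; omega)]

theorem IsCyc.mul {p a c : ℕ} {x z : Equiv.Perm (Fin n)} (hx : IsCyc p a x)
    (hz : IsCyc (p + a) c z) : IsCyc p (a + c) (x * z) := by
  intro i
  rw [Equiv.Perm.mul_apply, hx, hz]
  split_ifs <;> omega

theorem T_mul_T_of_isCyc {p a c : ℕ} {x z : Equiv.Perm (Fin n)} (hx : IsCyc p a x)
    (hz : IsCyc (p + a) c z) : (T q z * T q x : Hecke R q n) = T q (x * z) := by
  refine T_mul_T q fun i j hij hlt ↦ ?_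
  rw [Fin.lt_def] at *
  rw [hx, hx]
  rw [hz, hz] at *
  split_ifs at * <;> omega

/-- A `q`-analogue of Pascal's rule. The smallest letter `p` is the image of the first letter of one
of the two blocks: either it is fixed, or it comes from the second block and the cycle `x` can be
split off. -/
theorem shuffleSum_succ_succ {p a c : ℕ} (hn : p + a + c + 2 ≤ n) {x : Equiv.Perm (Fin n)}
    (hx : IsCyc p (a + 1) x) :
    (shuffleSum q p (a + 1) (c + 1) : Hecke R q n) =
      shuffleSum q (p + 1) a (c + 1) + T q x * shuffleSum q (p + 1) (a + 1) c := by
  classical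
  obtain ⟨P, hP⟩ : ∃ P : Fin n, P.1 = p := ⟨⟨p, by omega⟩, rfl⟩
  obtain ⟨Q, hQ⟩ : ∃ Q : Fin n, Q.1 = p + (a + 1) := ⟨⟨p + (a + 1), by omega⟩, rfl⟩
  have hxQ : x Q = P := Fin.ext (by rw [hx, hP]; split_ifs <;> omega)
  rw [shuffleSum, shuffleSum, shuffleSum, ← Finset.sum_filter_add_sum_filter_not _
    (fun w : Equiv.Perm (Fin n) ↦ w P = P), Finset.filter_filter, Finset.filter_filter,
    Finset.mul_sum]
  congr 1
  · refine Finset.sum_congr (Finset.filter_congr fun w _ ↦ ⟨?_, fun h ↦ ⟨⟨?_, ?_, ?_⟩, ?_⟩⟩)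
      fun _ _ ↦ rfl
    · rintro ⟨h, hw⟩
      refine ⟨fun i hi' ↦ ?_, fun i j hi' hij hj ↦ h.incr_left i j (by omega) hij (by omega),
        fun i j hi' hij hj ↦ h.incr_right i j (by omega) hij (by omega)⟩
      by_cases hiP : i = P
      · rw [hiP, hw]
      · have : i.1 ≠ P.1 := fun e ↦ hiP (Fin.ext e)
        exact h.fix i (by omega)
    · exact fun i hi' ↦ h.fix i (by omega)
    · intro i j hi' hij hj
      rcases Nat.eq_or_lt_of_le hi' with e | hlt
      · have e' : w i = i := h.fix i (by omega)
        rw [Fin.lt_def] at *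
        have := h.le_apply (k := j) (by omega)
        rw [e']
        omega
      · exact h.incr_left i j (by omega) hij (by omega)
    · exact fun i j hi' hij hj ↦ h.incr_right i j (by omega) hij (by omega)
    · exact h.fix P (by omega)
  symm
  refine Finset.sum_bij (fun w _ ↦ w * x) ?_ ?_ ?_ ?_
  · intro w h
    simp only [Finset.mem_filter, Finset.mem_univ, true_and] at h ⊢
    refine ⟨⟨fun i hi' ↦ ?_, fun i j hi' hij hj ↦ ?_, fun i j hi' hij hj ↦ ?_⟩, fun e ↦ ?_⟩
    · have e : x i = i := Fin.ext (by rw [hx]; split_ifs <;> omega)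
      rw [Equiv.Perm.mul_apply, e, h.fix i (by omega)]
    · rw [Fin.lt_def] at hij
      have e1 := hx i
      have e2 := hx j
      rw [if_pos (by omega)] at e1 e2
      exact h.incr_left _ _ (by omega) (by rw [Fin.lt_def]; omega) (by omega)
    · rw [Fin.lt_def] at hij
      have e2 : x j = j := Fin.ext (by rw [hx]; split_ifs <;> omega)
      rw [Equiv.Perm.mul_apply, Equiv.Perm.mul_apply, e2]
      rcases Nat.eq_or_lt_of_le hi' with e | hlt
      · have e1 : x i = P := by rw [← hxQ]; exact congrArg x (Fin.ext (by omega))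
        rw [e1, h.fix P (by omega), Fin.lt_def]
        have := h.le_apply (k := j) (by omega)
        omega
      · have e1 : x i = i := Fin.ext (by rw [hx]; split_ifs <;> omega)
        rw [e1]
        exact h.incr_right i j (by omega) (by rwa [Fin.lt_def]) (by omega)
    · have e1 := hx P
      rw [if_pos (by omega)] at e1
      rw [Equiv.Perm.mul_apply, ← h.fix P (by omega)] at e
      have := congrArg Fin.val (w.injective e)
      rw [h.fix P (by omega)] at this
      omega
  · intro v _ w _ e
    exact mul_right_cancel e
  · intro w hw
    simp only [Finset.mem_filter, Finset.mem_univ, true_and] at hw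
    obtain ⟨h, hwP⟩ := hw
    have hwQ : w Q = P := by
      obtain ⟨k, hk⟩ := w.surjective P
      have hkp : p ≤ k.1 := by
        by_contra hc
        rw [h.fix k (by omega)] at hk
        rw [hk] at hc
        omega
      have hkP : k ≠ P := by rintro rfl; exact hwP hk
      have hkP' : k.1 ≠ P.1 := fun e ↦ hkP (Fin.ext e)
      rcases lt_trichotomy k.1 Q.1 with hlt | heq | hgt
      · have h1 := h.incr_left P k (by omega) (by rw [Fin.lt_def]; omega) (by omega)
        have h2 := h.le_apply (k := P) (by omega)
        rw [hk, Fin.lt_def] at h1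
        omega
      · rwa [← Fin.ext heq]
      · have hkl : k.1 < p + (a + 1) + (c + 1) := by
          by_contra hc
          rw [h.fix k (by omega)] at hk
          exact hkP hk
        have h1 := h.incr_right Q k (by omega) (by rw [Fin.lt_def]; omega) (by omega)
        have h2 := h.le_apply (k := Q) (by omega)
        rw [hk, Fin.lt_def] at h1
        omega
    refine ⟨w * x⁻¹, ?_, by simp⟩
    simp only [Finset.mem_filter, Finset.mem_univ, true_and]
    refine ⟨fun i hi' ↦ ?_, fun i j hi' hij hj ↦ ?_, fun i j hi' hij hj ↦ ?_⟩
    · obtain ⟨k, rfl⟩ := x.surjective i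
      simp only [Equiv.Perm.mul_apply, Equiv.Perm.inv_def, Equiv.symm_apply_apply]
      by_cases hkQ : k = Q
      · rw [hkQ, hwQ, hxQ]
      · have hkQ' : k.1 ≠ Q.1 := fun e ↦ hkQ (Fin.ext e)
        have e1 := hx k
        have e2 : x k = k := Fin.ext (by rw [hx]; split_ifs at e1 ⊢ <;> omega)
        rw [e2] at hi' e1 ⊢
        exact h.fix k (by split_ifs at e1 <;> omega)
    · obtain ⟨k, rfl⟩ := x.surjective i
      obtain ⟨l, rfl⟩ := x.surjective j
      simp only [Equiv.Perm.mul_apply, Equiv.Perm.inv_def, Equiv.symm_apply_apply]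
      rw [Fin.lt_def] at hij
      have e1 := hx k
      have e2 := hx l
      apply h.incr_left k l _ _ _
      · split_ifs at e1 e2 <;> omega
      · rw [Fin.lt_def]; split_ifs at e1 e2 <;> omega
      · split_ifs at e1 e2 <;> omega
    · obtain ⟨k, rfl⟩ := x.surjective i
      obtain ⟨l, rfl⟩ := x.surjective j
      simp only [Equiv.Perm.mul_apply, Equiv.Perm.inv_def, Equiv.symm_apply_apply]
      rw [Fin.lt_def] at hij
      have e1 := hx k
      have e2 := hx l
      apply h.incr_right k l _ _ _
      · split_ifs at e1 e2 <;> omega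
      · rw [Fin.lt_def]; split_ifs at e1 e2 <;> omega
      · split_ifs at e1 e2 <;> omega
  · intro w h
    simp only [Finset.mem_filter, Finset.mem_univ, true_and] at h
    refine T_mul_T q fun i j hij hlt ↦ ?_
    rw [Fin.lt_def] at hij hlt
    have e1 := hx i
    have e2 := hx j
    -- The cycle `x` inverts only pairs whose larger letter goes to `P`; `w` fixes `P` and keeps it
    -- below the others, so lengths add.
    have hj : x j = P := Fin.ext (by split_ifs at e1 e2 <;> omega)
    rw [hj, h.fix P (by omega), Fin.lt_def]
    have := h.le_apply (k := x i) (by rw [hj] at hlt; omega)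
    omega

/-- The long cycle shifts the letters `p, …, p + a + c - 1` up by one, so conjugation by it moves
the shuffles from `p` to `p + 1`. -/
theorem shuffleSum_mul_T {p a c : ℕ} {y : Equiv.Perm (Fin n)} (hn : p + a + c < n)
    (hy : IsCyc p (a + c) y) :
    (shuffleSum q p a c * T q y : Hecke R q n) = T q y * shuffleSum q (p + 1) a c := by
  classical
  obtain ⟨P, hP⟩ : ∃ P : Fin n, P.1 = p := ⟨⟨p, by omega⟩, rfl⟩
  rw [shuffleSum, shuffleSum, Finset.sum_mul, Finset.mul_sum]
  have hyi : ∀ i : Fin n, p ≤ i.1 → i.1 < p + a + c → (y i).1 = i.1 + 1 := fun i h1 h2 ↦ by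
    rw [hy, if_pos (by omega)]
  refine Finset.sum_bij (fun w _ ↦ y * w * y⁻¹) ?_ ?_ ?_ ?_
  · intro w h
    simp only [Finset.mem_filter, Finset.mem_univ, true_and] at h ⊢
    refine ⟨fun i hi' ↦ ?_, fun i j hi' hij hj ↦ ?_, fun i j hi' hij hj ↦ ?_⟩
    · obtain ⟨k, rfl⟩ := y.surjective i
      simp only [Equiv.Perm.mul_apply, Equiv.Perm.inv_def, Equiv.symm_apply_apply]
      have e1 := hy k
      rw [h.fix k (by split_ifs at e1 <;> omega)]
    all_goals
      obtain ⟨k, rfl⟩ := y.surjective i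
      obtain ⟨l, rfl⟩ := y.surjective j
      simp only [Equiv.Perm.mul_apply, Equiv.Perm.inv_def, Equiv.symm_apply_apply]
      rw [Fin.lt_def] at hij
      have e1 := hy k
      have e2 := hy l
      have hk : p ≤ k.1 ∧ k.1 < p + a + c := by split_ifs at e1 <;> omega
      have hl : p ≤ l.1 ∧ l.1 < p + a + c := by split_ifs at e2 <;> omega
      rw [if_pos (by omega)] at e1 e2
      rw [Fin.lt_def, hyi _ (h.le_apply hk.1) (h.apply_lt hk.2),
        hyi _ (h.le_apply hl.1) (h.apply_lt hl.2)]
      simp only [add_lt_add_iff_right, ← Fin.lt_def]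
    · exact h.incr_left k l (by omega) (by rw [Fin.lt_def]; omega) (by omega)
    · exact h.incr_right k l (by omega) (by rw [Fin.lt_def]; omega) (by omega)
  · intro v _ w _ e
    simpa using e
  · intro w h
    simp only [Finset.mem_filter, Finset.mem_univ, true_and] at h
    refine ⟨y⁻¹ * w * y, ?_, by simp [mul_assoc]⟩
    simp only [Finset.mem_filter, Finset.mem_univ, true_and]
    have key : ∀ i : Fin n, p ≤ i.1 → i.1 < p + a + c →
        (w (y i)).1 = ((y⁻¹ * w * y) i).1 + 1 := by
      intro i h1 h2
      obtain ⟨k, hk⟩ := y.surjective (w (y i))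
      simp only [Equiv.Perm.mul_apply, Equiv.Perm.inv_def, ← hk, Equiv.symm_apply_apply]
      have e1 := hyi i h1 h2
      have h3 := h.le_apply (k := y i) (by omega)
      have h4 := h.apply_lt (k := y i) (by omega)
      rw [← hk] at h3 h4
      have e2 := hy k
      split_ifs at e2 <;> omega
    refine ⟨fun i hi' ↦ ?_, fun i j hi' hij hj ↦ ?_, fun i j hi' hij hj ↦ ?_⟩
    · have e1 := hy i
      rw [Equiv.Perm.mul_apply, Equiv.Perm.mul_apply,
        h.fix (y i) (by split_ifs at e1 <;> omega)]
      simp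
    · rw [Fin.lt_def] at hij
      have e1 := hyi i (by omega) (by omega)
      have e2 := hyi j (by omega) (by omega)
      have := h.incr_left (y i) (y j) (by omega) (by rw [Fin.lt_def]; omega) (by omega)
      rw [Fin.lt_def, key i (by omega) (by omega), key j (by omega) (by omega)] at this
      rw [Fin.lt_def]
      omega
    · rw [Fin.lt_def] at hij
      have e1 := hyi i (by omega) (by omega)
      have e2 := hyi j (by omega) (by omega)
      have := h.incr_right (y i) (y j) (by omega) (by rw [Fin.lt_def]; omega) (by omega)
      rw [Fin.lt_def, key i (by omega) (by omega), key j (by omega) (by omega)] at this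
      rw [Fin.lt_def]
      omega
  · intro w h
    simp only [Finset.mem_filter, Finset.mem_univ, true_and] at h
    rw [T_mul_T q, T_mul_T q, mul_assoc, inv_mul_cancel, mul_one]
    · intro i j hij hlt
      simp only [Equiv.Perm.mul_apply, Equiv.Perm.inv_def, Equiv.symm_apply_apply]
      have e1 := hy i
      have e2 := hy j
      rw [Fin.lt_def] at hij hlt ⊢
      have hj : j.1 = p + (a + c) ∧ p ≤ i.1 := by split_ifs at e1 e2 <;> omega
      have h3 := h.le_apply hj.2
      have h4 := h.apply_lt (k := i) (by omega)
      rw [h.fix j (by omega), hyi _ h3 h4, e2, if_neg (by omega), if_pos hj.1]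
      omega
    · intro i j hij hlt
      obtain ⟨h1, h2, h3, h4⟩ := h.mem_of_inversion hij hlt
      rw [Fin.lt_def] at hlt ⊢
      rw [hyi _ (h.le_apply h1) (h.apply_lt (by omega)), hyi _ (h.le_apply (by omega))
        (h.apply_lt h4)]
      omega

/-- The Garnir elements lie in the right ideal generated by the `m_f C(m; a, t)`. -/
theorem symSum_mul_shuffleSum_mem {f : Fin n → ℕ} (hf : Monotone f) {m a b : ℕ}
    (hn : m + a + b ≤ n) (hba : b ≤ a)
    (hconst : ∀ i j : Fin n, m + a ≤ i.1 → i.1 < m + a + b → m + a ≤ j.1 → j.1 < m + a + b →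
      f i = f j)
    {I : Submodule (Hecke R q n)ᵐᵒᵖ (Hecke R q n)}
    (hI : ∀ t, 1 ≤ t → t ≤ b → symSum q f * shuffleSum q m a t ∈ I) (s : ℕ) :
    ∀ c, s < c → c ≤ b → symSum q f * shuffleSum q (m + s) (a - s) c ∈ I := by
  -- Pascal's rule writes the sum for `s + 1` as a difference of the sum for `s` and a term `T_x C`.
  -- The latter reduces to the case of `s` with one letter fewer in the second block, which is why
  -- `s < c` is carried along.
  induction s with
  | zero => exact fun c h1 h2 ↦ hI c h1 h2
  | succ s ih =>
    intro c h1 h2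
    obtain ⟨c, rfl⟩ : ∃ c', c = c' + 1 := ⟨c - 1, by omega⟩
    -- The subtraction is not truncated, since `s < b ≤ a`.
    obtain ⟨A, hA⟩ : ∃ A, a - s = A + 1 := ⟨a - s - 1, by omega⟩
    obtain ⟨x, hx⟩ := exists_isCyc (n := n) (p := m + s) (k := A + 1) (by omega)
    obtain ⟨z, hz⟩ := exists_isCyc (n := n) (p := m + s + (A + 1)) (k := c) (by omega)
    have hzf : z ∈ stab f := by
      intro i
      have e := hz i
      by_cases hi' : m + a ≤ i.1 ∧ i.1 < m + a + b
      · apply hconst _ _ _ _ hi'.1 hi'.2 <;> split_ifs at e <;> omega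
      · exact congrArg f (Fin.ext (by split_ifs at e <;> omega))
    have e1 := shuffleSum_succ_succ (R := R) q (n := n) (p := m + s) (a := A) (c := c)
      (by omega) hx
    have e2 := shuffleSum_mul_T (R := R) q (n := n) (p := m + s) (a := A + 1) (c := c)
      (by omega) (hx.mul hz)
    rw [← T_mul_T_of_isCyc q hx hz] at e2
    -- The product `T_z T_x` belongs to the long cycle that moves the shuffle sum from `m + s` to `m
    -- + s + 1`, and `z` acts inside a block of `f`, so `m_f` absorbs `T_z` up to a power of `q`.
    have e3 : symSum q f * (T q x * shuffleSum q (m + s + 1) (A + 1) c) =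
        (↑(q⁻¹ ^ length z) : R) • (symSum q f * shuffleSum q (m + s) (A + 1) c *
          (T q z * T q x) : Hecke R q n) := by
      rw [mul_assoc (symSum q f), e2, mul_assoc (T q z), ← mul_assoc (symSum q f) (T q z),
        symSum_mul_T q hf hzf, smul_mul_assoc, smul_smul]
      have : (↑(q⁻¹ ^ length z) : R) * (q : R) ^ length z = 1 := by
        rw [← Units.val_pow_eq_pow_val, ← Units.val_mul]
        simp
      rw [this, one_smul]
    have h3 := ih (c + 1) (by omega) h2
    have h4 := ih c (by omega) (by omega)
    rw [hA] at h3 h4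
    rw [e1, mul_add, e3] at h3
    have h5 : (↑(q⁻¹ ^ length z) : R) • (symSum q f * shuffleSum q (m + s) (A + 1) c *
          (T q z * T q x) : Hecke R q n) ∈ I := by
      rw [← mul_smul_comm]
      exact I.smul_mem (MulOpposite.op _) h4
    rw [show a - (s + 1) = A by omega, ← add_assoc]
    simpa using I.sub_mem h3 h5

end TwoBlocks

/-! ### Straightening -/

section Straightening

variable {n : ℕ}

/-- The row of `𝔱^μ` that contains a letter. -/
def rowOf (μ : Composition n) (i : Fin n) : ℕ := (μ.index i).1

theorem rowOf_lt_iff (μ : Composition n) (i : Fin n) (k : ℕ) :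
    rowOf μ i < k ↔ i.1 < μ.sizeUpTo k := by
  constructor
  · intro h
    exact (μ.lt_sizeUpTo_index_succ i).trans_le (μ.monotone_sizeUpTo h)
  · intro h
    by_contra hc
    have h1 := μ.sizeUpTo_index_le i
    have h2 := μ.monotone_sizeUpTo (not_lt.1 hc)
    exact absurd (h.trans_le (h2.trans h1)) (lt_irrefl _)

theorem monotone_rowOf (μ : Composition n) : Monotone (rowOf μ) := by
  intro i j hij
  rw [← Nat.lt_succ_iff, rowOf_lt_iff]
  exact lt_of_le_of_lt (Fin.le_def.1 hij) ((rowOf_lt_iff μ j _).1 (Nat.lt_succ_self _))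

theorem rowOf_initialTableau (μ : Composition n) (x : Σ r : Fin μ.length, Fin (μ.blocksFun r)) :
    rowOf μ (initialTableau μ x) = x.1.1 :=
  congrArg Fin.val (μ.index_embedding x.1 x.2)

theorem initialTableau_val (μ : Composition n) (x : Σ r : Fin μ.length, Fin (μ.blocksFun r)) :
    (initialTableau μ x).1 = μ.sizeUpTo x.1 + x.2 := μ.coe_embedding x.1 x.2

theorem mem_rowStabilizer_iff (μ : Composition n) (w : Equiv.Perm (Fin n)) :
    w ∈ rowStabilizer μ ↔ w ∈ stab (rowOf μ) :=
  forall_congr' fun _ ↦ Fin.ext_iff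

theorem perm_initialTableau_trans (μ : Composition n) (w : Equiv.Perm (Fin n)) :
    Tableau.perm (μ := μ) ((initialTableau μ).trans w) = w := by
  ext i
  simp [Tableau.perm]

/-- Order down a column follows from order between adjacent rows, because in a partition the rows in
between also reach that column. -/
theorem exists_of_not_isStandard {μ : Composition n} (hμ : IsPartition μ) {w : Equiv.Perm (Fin n)}
    (hw : IncrOn (rowOf μ) w)
    (h : ¬ Tableau.IsStandard (μ := μ) ((initialTableau μ).trans w)) :
    ∃ (d : ℕ) (hd : d + 1 < μ.length) (c : ℕ) (_ : c < μ.blocksFun ⟨d + 1, hd⟩) (i j : Fin n),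
      i.1 = μ.sizeUpTo d + c ∧ j.1 = μ.sizeUpTo (d + 1) + c ∧ w j < w i := by
  by_contra! hc
  refine h ⟨fun r c c' hcc ↦ hw _ _ ?_ ?_, fun r r' c c' hrr hcc ↦ ?_⟩
  · rw [Fin.lt_def, initialTableau_val, initialTableau_val]
    simpa using hcc
  · rw [rowOf_initialTableau, rowOf_initialTableau]
  obtain ⟨r', hr'⟩ := r'
  rw [Fin.lt_def] at hrr
  simp only at hrr
  induction r', hrr using Nat.le_induction with
  | base =>
    refine lt_of_le_of_ne (hc r hr' c' c'.2 _ _ ?_ ?_) fun e ↦ ?_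
    · simp [initialTableau_val, hcc]
    · simp [initialTableau_val]
    · have := congrArg Sigma.fst ((Equiv.injective _) e)
      have := congrArg Fin.val this
      simp at this
  | succ k hk ih =>
    have hk' : c'.1 < μ.blocksFun ⟨k, by omega⟩ :=
      c'.2.trans_le (hμ (by rw [Fin.le_def]; simp))
    refine lt_of_lt_of_le (ih (by omega) ⟨c'.1, hk'⟩ hcc) (hc k hr' c' c'.2 _ _ ?_ ?_)
    · simp [initialTableau_val]
    · simp [initialTableau_val]

variable {R : Type u} [CommRing R] (q : Rˣ)

theorem mElt_eq_symSum (μ : Composition n) : (mElt q μ : Hecke R q n) = symSum q (rowOf μ) := by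
  classical
  rw [mElt, symSum]
  exact Finset.sum_congr (Finset.filter_congr fun w _ ↦ mem_rowStabilizer_iff μ w) fun _ _ ↦ rfl

/-- If the consecutive increasing sequences `w(p), …, w(p + a - 1)` and
`w(p + a), …, w(p + a + c - 1)` are such that the second lies below the first, then `T_w` is the
leading term of a multiple of the sum over shuffles. -/
theorem exists_shuffleSum_mul_T {p a c : ℕ} (ha : 1 ≤ a) (hc : 1 ≤ c)
    {w : Equiv.Perm (Fin n)}
    (h1 : ∀ i j : Fin n, p ≤ i.1 → i < j → j.1 < p + a → w i < w j)
    (h2 : ∀ i j : Fin n, p + a ≤ i.1 → i < j → j.1 < p + a + c → w i < w j)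
    (h3 : ∀ i j : Fin n, p ≤ i.1 → i.1 < p + a → p + a ≤ j.1 → j.1 < p + a + c → w j < w i) :
    ∃ w' : Equiv.Perm (Fin n), ∃ z ∈ Submodule.span R (T q '' {v | length v < length w}),
      (shuffleSum q p a c * T q w' : Hecke R q n) = T q w + z := by
  classical
  -- The labelling `g` merges the two blocks. Then `w = w' * u₀` with `w'` increasing on the merged
  -- block and `u₀` the shuffle with the same relative order as `w`.
  set g : Fin n → ℕ := fun i ↦ if p ≤ i.1 ∧ i.1 < p + a + c then p else i.1 with hg_def
  have hg : Monotone g := by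
    intro i j hij
    rw [Fin.le_def] at hij
    simp only [g]
    split_ifs <;> omega
  obtain ⟨v, hv, hwv⟩ := exists_mul_incrOn hg w
  obtain ⟨w', hw'⟩ : ∃ w', w' = w * v := ⟨_, rfl⟩
  obtain ⟨u₀, hu₀⟩ : ∃ u, u = v⁻¹ := ⟨_, rfl⟩
  have hw : w = w' * u₀ := by rw [hw', hu₀, mul_inv_cancel_right]
  have hus : u₀ ∈ stab g := hu₀ ▸ inv_mem hv
  rw [← hw'] at hwv
  have hgi : ∀ i : Fin n, p ≤ i.1 → i.1 < p + a + c → g i = p := fun i h h' ↦ if_pos ⟨h, h'⟩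
  have hinv : ∀ i j : Fin n, p ≤ i.1 → i.1 < p + a + c → p ≤ j.1 → j.1 < p + a + c →
      u₀ i < u₀ j → w i < w j := by
    intro i j hi1 hi2 hj1 hj2 hlt
    rw [hw]
    exact hwv _ _ hlt (by rw [hus, hus, hgi i hi1 hi2, hgi j hj1 hj2])
  have hinv' : ∀ i j : Fin n, p ≤ i.1 → i.1 < p + a + c → p ≤ j.1 → j.1 < p + a + c →
      w i < w j → u₀ i < u₀ j := by
    intro i j hi1 hi2 hj1 hj2 hlt
    by_contra hcon
    rcases (not_lt.1 hcon).eq_or_lt with e | e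
    · rw [u₀.injective e] at hlt; exact hlt.false
    · exact hlt.not_gt (hinv j i hj1 hj2 hi1 hi2 e)
  have hsh : IsShuffle p a c u₀ := by
    refine ⟨fun i hi' ↦ Fin.ext ?_, fun i j hi' hij hj ↦ ?_, fun i j hi' hij hj ↦ ?_⟩
    · have := hus i
      simp only [g] at this
      split_ifs at this <;> omega
    · have := Fin.lt_def.1 hij
      exact hinv' i j (by omega) (by omega) (by omega) (by omega) (h1 i j hi' hij hj)
    · have := Fin.lt_def.1 hij
      exact hinv' i j (by omega) (by omega) (by omega) (by omega) (h2 i j hi' hij hj)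
  have hadd : ∀ u : Equiv.Perm (Fin n), IsShuffle p a c u →
      ∀ i j, i < j → u j < u i → w' (u j) < w' (u i) := by
    intro u hu i j hij hlt
    obtain ⟨b1, b2, b3, b4⟩ := hu.mem_of_inversion hij hlt
    refine hwv _ _ hlt ?_
    rw [hgi _ (hu.le_apply (by omega)) (hu.apply_lt (by omega)),
      hgi _ (hu.le_apply (by omega)) (hu.apply_lt (by omega))]
  refine ⟨w', ∑ u : Equiv.Perm (Fin n) with IsShuffle p a c u ∧ u ≠ u₀, T q (w' * u), ?_, ?_⟩
  · refine Submodule.sum_mem _ fun u hu ↦ Submodule.subset_span ⟨_, ?_, rfl⟩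
    simp only [Finset.mem_filter, Finset.mem_univ, true_and] at hu
    -- A shuffle inverts only pairs from different blocks, and `h3` makes `u₀` invert all of those;
    -- hence `u₀` is the unique longest shuffle.
    have hsub : inversions u ⊆ inversions u₀ := by
      rintro ⟨i, j⟩ hij
      obtain ⟨hij, hlt⟩ := mem_inversions.1 hij
      obtain ⟨b1, b2, b3, b4⟩ := hu.1.mem_of_inversion hij hlt
      simp only at b1 b2 b3 b4
      exact mem_inversions.2 ⟨hij, hinv' j i (by omega) (by omega) (by omega) (by omega)
        (h3 i j b1 b2 b3 b4)⟩
    have hlt : length u < length u₀ := by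
      rw [length_eq_card_inversions, length_eq_card_inversions]
      exact Finset.card_lt_card (hsub.ssubset_of_ne fun e ↦ hu.2 (inversions_injective e))
    change length (w' * u) < length w
    rw [hw, length_mul_of_forall (hadd u hu.1), length_mul_of_forall (hadd u₀ hsh)]
    omega
  · rw [shuffleSum, Finset.sum_mul, Finset.sum_congr rfl fun u hu ↦ T_mul_T q (hadd u (by
      simpa using hu)), ← Finset.add_sum_erase _ _ (show u₀ ∈ _ by simpa using hsh), ← hw]
    congr 2
    ext u
    simp [and_comm]

/-- A right ideal as an `R`-submodule. -/
def rightIdealToSubmodule (I : Submodule (Hecke R q n)ᵐᵒᵖ (Hecke R q n)) :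
    Submodule R (Hecke R q n) where
  carrier := I
  add_mem' := I.add_mem
  zero_mem' := I.zero_mem
  smul_mem' r x hx := by
    have : r • x = MulOpposite.op (r • (1 : Hecke R q n)) • x := by
      rw [op_smul_eq_mul, mul_smul_comm, mul_one]
    rw [this]
    exact I.smul_mem _ hx

/-- The span of the `m_μ T_{d(𝔱)}` for standard tableaux `𝔱`. -/
noncomputable def standardSpan (μ : Composition n) : Submodule R (Hecke R q n) :=
  Submodule.span R {x | ∃ t : Tableau μ, t.IsStandard ∧ x = mElt q μ * T q t.perm}

/-- Induction on length. A descent inside a row is absorbed by `m_μ`; a violation between adjacent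
rows exhibits `T_w` as leading term of a multiple of a Garnir sum in the ideal. -/
theorem mElt_mul_T_mem {μ : Composition n} (hμ : IsPartition μ) (w : Equiv.Perm (Fin n)) :
    (mElt q μ * T q w : Hecke R q n) ∈
      rightIdealToSubmodule q (hIdeal q μ) ⊔ standardSpan q μ := by
  induction hk : length w using Nat.strong_induction_on generalizing w with
  | _ k ih =>
  by_cases h1 : ∃ i : Fin (n - 1), rowOf μ (lo i) = rowOf μ (hi i) ∧ w (hi i) < w (lo i)
  · obtain ⟨i, hfi, hwi⟩ := h1
    have hl := length_mul_simple_of_gt hwi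
    have e := gen_mul_T (R := R) q (w := w * simple i) (i := i) (by simpa using hwi)
    rw [mul_simple_mul_simple] at e
    rw [← e, ← mul_assoc, mElt_eq_symSum, symSum_mul_gen q _ hfi, smul_mul_assoc,
      ← mElt_eq_symSum]
    exact Submodule.smul_mem _ _ (ih _ (by omega) _ rfl)
  push Not at h1
  have hw : IncrOn (rowOf μ) w :=
    incrOn_of_forall_lo_lt_hi (monotone_rowOf μ) fun i h ↦ (h1 i h).not_gt
  by_cases hstd : Tableau.IsStandard (μ := μ) ((initialTableau μ).trans w)
  · refine Submodule.mem_sup_right (Submodule.subset_span ⟨_, hstd, ?_⟩)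
    rw [perm_initialTableau_trans]
  obtain ⟨d, hd, c, hcb, i₀, j₀, hi₀, hj₀, hlt⟩ := exists_of_not_isStandard hμ hw hstd
  have hba : μ.blocksFun ⟨d + 1, hd⟩ ≤ μ.blocksFun ⟨d, by omega⟩ := hμ (by rw [Fin.le_def]; simp)
  have hs1 := μ.sizeUpTo_succ' ⟨d, by omega⟩
  have hs2 := μ.sizeUpTo_succ' ⟨d + 1, hd⟩
  simp only at hs1 hs2
  have hs3 := μ.sizeUpTo_le (d + 1 + 1)
  set m := μ.sizeUpTo d with hm
  set a := μ.blocksFun ⟨d, by omega⟩ with ha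
  set b := μ.blocksFun ⟨d + 1, hd⟩ with hb
  have hrow : ∀ i : Fin n, m ≤ i.1 → i.1 < m + a → rowOf μ i = d := by
    intro i h h'
    have h2 := (rowOf_lt_iff μ i (d + 1)).2 (by omega)
    have h3 := mt (rowOf_lt_iff μ i d).1 (by omega)
    omega
  have hrow' : ∀ i : Fin n, m + a ≤ i.1 → i.1 < m + a + b → rowOf μ i = d + 1 := by
    intro i h h'
    have h2 := (rowOf_lt_iff μ i (d + 1 + 1)).2 (by omega)
    have h3 := mt (rowOf_lt_iff μ i (d + 1)).1 (by omega)
    omega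
  -- The Garnir belt takes the upper row from column `c` on and the lower row up to and including
  -- column `c`. Columns count from `0`, so the latter part has `c + 1` letters.
  have hmem : symSum q (rowOf μ) * shuffleSum q (m + c) (a - c) (c + 1) ∈ hIdeal (R := R) q μ := by
    refine symSum_mul_shuffleSum_mem q (monotone_rowOf μ) (b := b) (by omega) hba
      (fun i j h1 h2 h3 h4 ↦ by rw [hrow' i h1 h2, hrow' j h3 h4]) (fun t ht ht' ↦ ?_) c (c + 1)
      (by omega) (by omega)
    refine Submodule.subset_span ⟨d, hd, t, ht, ht', ?_⟩
    rw [hElt, cosetSum_eq_shuffleSum, mElt_eq_symSum]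
  have hleft : ∀ i j : Fin n, m ≤ i.1 → i < j → j.1 < m + a → w i < w j := fun i j h1 h2 h3 ↦ by
    have := Fin.lt_def.1 h2
    exact hw i j h2 (by rw [hrow i (by omega) (by omega), hrow j (by omega) (by omega)])
  have hright : ∀ i j : Fin n, m + a ≤ i.1 → i < j → j.1 < m + a + b → w i < w j :=
    fun i j h1 h2 h3 ↦ by
      have := Fin.lt_def.1 h2
      exact hw i j h2 (by rw [hrow' i (by omega) (by omega), hrow' j (by omega) (by omega)])
  obtain ⟨w', z, hz, hwz⟩ := exists_shuffleSum_mul_T (R := R) q (n := n) (p := m + c)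
    (a := a - c) (c := c + 1) (by omega) (by omega) (w := w)
    (fun i j h1 h2 h3 ↦ hleft i j (by omega) h2 (by omega))
    (fun i j h1 h2 h3 ↦ hright i j (by omega) h2 (by omega))
    -- Rows increase, so the one violation spreads to the whole belt: `w j ≤ w j₀ < w i₀ ≤ w i`.
    (fun i j h1 h2 h3 h4 ↦ by
      have l1 : w j ≤ w j₀ := by
        rcases (show j.1 ≤ j₀.1 by omega).eq_or_lt with e | e
        · rw [Fin.ext e]
        · exact (hright j j₀ (by omega) (by rwa [Fin.lt_def]) (by omega)).le
      have l2 : w i₀ ≤ w i := by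
        rcases (show i₀.1 ≤ i.1 by omega).eq_or_lt with e | e
        · rw [Fin.ext e]
        · exact (hleft i₀ i (by omega) (by rwa [Fin.lt_def]) (by omega)).le
      exact l1.trans_lt (hlt.trans_le l2))
  have e : (mElt q μ * T q w : Hecke R q n) =
      symSum q (rowOf μ) * shuffleSum q (m + c) (a - c) (c + 1) * T q w' - mElt q μ * z := by
    rw [mul_assoc, hwz, mul_add, ← mElt_eq_symSum]
    abel
  rw [e]
  refine Submodule.sub_mem _ (Submodule.mem_sup_left ?_) ?_
  · exact (hIdeal q μ).smul_mem (MulOpposite.op (T q w')) hmem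
  · clear hwz e
    induction hz using Submodule.span_induction with
    | mem y hy =>
      obtain ⟨v, hv, rfl⟩ := hy
      exact ih _ (hk ▸ hv) v rfl
    | zero => simp
    | add y z _ _ hy hz => rw [mul_add]; exact add_mem hy hz
    | smul r y _ hy => rw [mul_smul_comm]; exact Submodule.smul_mem _ _ hy

/-- `M^μ` is spanned modulo the right ideal of the theorem by the `m_μ T_{d(𝔱)}` for standard
tableaux `𝔱`. -/
theorem mElt_mul_mem {μ : Composition n} (hμ : IsPartition μ) (x : Hecke R q n) :
    mElt q μ * x ∈ rightIdealToSubmodule q (hIdeal q μ) ⊔ standardSpan q μ := by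
  induction x using T_induction_span with
  | T_mem w => exact mElt_mul_T_mem q hμ w
  | zero => simp
  | add x y hx hy => rw [mul_add]; exact add_mem hx hy
  | smul r x hx => rw [mul_smul_comm]; exact Submodule.smul_mem _ _ hx

end Straightening

/-! ### Dominance and sorting of blocks -/

section Dominance

variable {n : ℕ}

theorem Dominates.trans {κ ν μ : Composition n} (h : Dominates κ ν) (h' : Dominates ν μ) :
    Dominates κ μ := fun k ↦ (h' k).trans (h k)

theorem Dominates.antisymm {ν μ : Composition n} (h : Dominates ν μ) (h' : Dominates μ ν) :
    ν = μ := by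
  have hs : ∀ k, ν.sizeUpTo k = μ.sizeUpTo k := fun k ↦ le_antisymm (h' k) (h k)
  have hlen : ∀ κ κ' : Composition n, (∀ k, κ.sizeUpTo k = κ'.sizeUpTo k) →
      κ.length ≤ κ'.length := by
    intro κ κ' hk
    by_contra hc
    have h1 := κ.sizeUpTo_strict_mono (not_le.1 hc)
    rw [hk, κ'.sizeUpTo_length] at h1
    exact absurd (κ.sizeUpTo_le _) (not_le.2 h1)
  have hl : ν.length = μ.length := le_antisymm (hlen _ _ hs) (hlen _ _ fun k ↦ (hs k).symm)
  ext1
  refine List.ext_getElem hl fun i h1 h2 ↦ ?_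
  have e1 := ν.sizeUpTo_succ h1
  have e2 := μ.sizeUpTo_succ h2
  have := hs i
  have := hs (i + 1)
  omega

theorem StrictlyDominates.trans_dominates {κ ν μ : Composition n} (h : StrictlyDominates κ ν)
    (h' : Dominates ν μ) : StrictlyDominates κ μ :=
  ⟨h.1.trans h', fun e ↦ h.2 (h.1.antisymm (e ▸ h'))⟩

/-- The more dominant composition counts as the smaller one, so induction starts at the top of the
dominance order. -/
theorem wellFounded_strictlyDominates :
    WellFounded (StrictlyDominates : Composition n → Composition n → Prop) :=
  have : IsTrans (Composition n) StrictlyDominates := ⟨fun _ _ _ h h' ↦ h.trans_dominates h'.1⟩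
  have : Std.Irrefl (StrictlyDominates : Composition n → Composition n → Prop) :=
    ⟨fun _ h ↦ h.2 rfl⟩
  Finite.wellFounded_of_trans_of_irrefl _

theorem card_rowOf_lt (μ : Composition n) (k : ℕ) :
    (Finset.univ.filter fun j : Fin n ↦ rowOf μ j < k).card = μ.sizeUpTo k := by
  simp only [rowOf_lt_iff]
  rw [Fin.card_filter_val_lt]
  exact min_eq_right (μ.sizeUpTo_le k)

theorem card_rowOf_eq (μ : Composition n) (r : Fin μ.length) :
    (Finset.univ.filter fun j : Fin n ↦ rowOf μ j = r).card = μ.blocksFun r := by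
  have h1 := card_rowOf_lt μ (r + 1)
  rw [μ.sizeUpTo_succ', ← card_rowOf_lt μ r] at h1
  have h2 : (Finset.univ.filter fun j : Fin n ↦ rowOf μ j < r + 1) =
      (Finset.univ.filter fun j : Fin n ↦ rowOf μ j < r) ∪
        (Finset.univ.filter fun j : Fin n ↦ rowOf μ j = r) := by
    ext j
    simp only [Finset.mem_filter, Finset.mem_univ, true_and, Finset.mem_union]
    omega
  rw [h2, Finset.card_union_of_disjoint] at h1
  · omega
  · rw [Finset.disjoint_filter]
    intro j _
    omega

/-- Outside the common part, the terms of `s` are at most `v k` and those of the initial segment at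
least `v k`, and the latter are no fewer. -/
theorem sum_le_sum_of_antitone {b : ℕ} {v : Fin b → ℕ} (hv : Antitone v) (s : Finset (Fin b))
    {k : ℕ} (hs : s.card ≤ k) : ∑ i ∈ s, v i ≤ ∑ i : Fin b with i.1 < k, v i := by
  rcases le_or_gt b k with hb | hb
  · exact Finset.sum_le_sum_of_subset fun i _ ↦ by simp; omega
  set A : Finset (Fin b) := {i : Fin b | i.1 < k} with hA
  have hAc : A.card = k := by rw [hA, Fin.card_filter_val_lt]; omega
  have hsA : (s \ A).card ≤ (A \ s).card := by
    have h1 := Finset.card_sdiff_add_card_inter s A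
    have h2 := Finset.card_sdiff_add_card_inter A s
    rw [Finset.inter_comm] at h2
    omega
  rw [← Finset.sum_inter_add_sum_sdiff s A, ← Finset.sum_inter_add_sum_sdiff A s,
    Finset.inter_comm A s]
  refine Nat.add_le_add_left ?_ _
  calc ∑ i ∈ s \ A, v i ≤ (s \ A).card • v ⟨k, hb⟩ := Finset.sum_le_card_nsmul _ _ _ fun i hi ↦ by
        simp only [hA, Finset.mem_sdiff, Finset.mem_filter, Finset.mem_univ, true_and] at hi
        exact hv (by rw [Fin.le_def]; simp only; omega)
    _ ≤ (A \ s).card • v ⟨k, hb⟩ := Nat.mul_le_mul_right _ hsA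
    _ ≤ ∑ i ∈ A \ s, v i := Finset.card_nsmul_le_sum _ _ _ fun i hi ↦ by
        simp only [hA, Finset.mem_sdiff, Finset.mem_filter, Finset.mem_univ, true_and] at hi
        exact hv (by rw [Fin.le_def]; simp only; omega)

/-- Sorting the blocks of a labelling gives a partition, with partial sums at least those of the
labelling. -/
theorem exists_partition_perm (f : Fin n → ℕ) :
    ∃ ν : Composition n, IsPartition ν ∧
      (∀ k, (Finset.univ.filter fun j ↦ f j < k).card ≤ ν.sizeUpTo k) ∧
      ∃ x : Equiv.Perm (Fin n), ∀ i j, f i = f j ↔ rowOf ν (x i) = rowOf ν (x j) := by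
  classical
  set L : Finset ℕ := Finset.univ.image f with hL
  set e := L.orderIsoOfFin rfl with he
  set c : Fin L.card → ℕ := fun i ↦ (Finset.univ.filter fun j ↦ f j = (e i).1).card with hc
  -- The order dual makes the block sizes decrease; `F` below sends a letter to the rank of its
  -- block.
  set σ := Tuple.sort fun i ↦ OrderDual.toDual (c i) with hσ
  set v : Fin L.card → ℕ := fun i ↦ c (σ i) with hv_def
  have hv : Antitone v := fun i j hij ↦ Tuple.monotone_sort (fun i ↦ OrderDual.toDual (c i)) hij
  have hfL : ∀ j, f j ∈ L := fun j ↦ Finset.mem_image_of_mem f (Finset.mem_univ j)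
  set F : Fin n → Fin L.card := fun j ↦ σ⁻¹ (e.symm ⟨f j, hfL j⟩) with hF
  have hFiff : ∀ j i, F j = i ↔ f j = (e (σ i)).1 := by
    intro j i
    rw [hF]
    simp only
    rw [Equiv.Perm.inv_eq_iff_eq, OrderIso.symm_apply_eq, Subtype.ext_iff]
  have hFv : ∀ i, (Finset.univ.filter fun j ↦ F j = i).card = v i := by
    intro i
    simp only [hFiff, hv_def, hc]
  have hsum : ∑ i, v i = n := by
    have := Finset.card_eq_sum_card_fiberwise (f := F) (s := (Finset.univ : Finset (Fin n)))
      (t := Finset.univ) fun _ _ ↦ Finset.mem_coe.2 (Finset.mem_univ _)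
    rw [Finset.card_univ, Fintype.card_fin] at this
    rw [this]
    exact Finset.sum_congr rfl fun i _ ↦ (hFv i).symm
  have hpos : ∀ i, 0 < v i := by
    intro i
    obtain ⟨j, -, hj⟩ := Finset.mem_image.1 (e (σ i)).2
    rw [← hFv]
    exact Finset.card_pos.2 ⟨j, by simpa [hFiff] using hj⟩
  let ν : Composition n :=
    { blocks := List.ofFn v
      blocks_pos := by
        intro i hi'
        obtain ⟨k, rfl⟩ := (List.mem_ofFn' v i).1 hi'
        exact hpos k
      blocks_sum := by rw [List.sum_ofFn, hsum] }
  have hlen : ν.length = L.card := List.length_ofFn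
  have hblocks : ∀ i : Fin ν.length, ν.blocksFun i = v (Fin.cast hlen i) := by
    intro i
    simp only [Composition.blocksFun, ν, List.get_eq_getElem, List.getElem_ofFn]
    rfl
  have hsize : ∀ k, ν.sizeUpTo k = ∑ i : Fin L.card with i.1 < k, v i := by
    intro k
    exact List.sum_take_ofFn v k
  refine ⟨ν, fun i j hij ↦ ?_, fun k ↦ ?_, ?_⟩
  · rw [hblocks, hblocks]
    exact hv hij
  · rw [hsize]
    -- The letters with label below `k` fill at most `k` blocks, and no `k` blocks hold more letters
    -- than the `k` largest.
    have h1 : (Finset.univ.filter fun j ↦ f j < k).card =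
        ∑ i : Fin L.card with (e (σ i)).1 < k, v i := by
      rw [Finset.card_eq_sum_card_fiberwise (f := F)
        (t := Finset.univ.filter fun i : Fin L.card ↦ (e (σ i)).1 < k)]
      · refine Finset.sum_congr rfl fun i hi' ↦ ?_
        rw [← hFv, Finset.filter_filter]
        congr 1
        refine Finset.filter_congr fun j _ ↦ ?_
        simp only [Finset.mem_filter, Finset.mem_univ, true_and] at hi'
        rw [hFiff]
        exact ⟨fun h ↦ h.2, fun h ↦ ⟨h ▸ hi', h⟩⟩
      · intro j hj
        simp only [Finset.coe_filter, Finset.mem_univ, true_and, Set.mem_ofPred_eq] at hj ⊢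
        rwa [← (hFiff j (F j)).1 rfl]
    rw [h1]
    refine sum_le_sum_of_antitone hv _ ?_
    rw [← Finset.card_range k]
    refine Finset.card_le_card_of_injOn (fun i ↦ (e (σ i)).1) ?_ ?_
    · intro i hi'
      simpa using hi'
    · intro i _ j _ hij
      exact σ.injective (e.injective (Subtype.ext hij))
  · set G : Fin n → Fin L.card := fun j ↦ Fin.cast hlen (ν.index j) with hG
    have hcard : ∀ i, Fintype.card {j // F j = i} = Fintype.card {j // G j = i} := by
      intro i
      rw [Fintype.card_subtype, Fintype.card_subtype, hFv]
      have := card_rowOf_eq ν (Fin.cast hlen.symm i)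
      rw [hblocks] at this
      rw [show v i = v (Fin.cast hlen (Fin.cast hlen.symm i)) from rfl, ← this]
      congr 1
      refine Finset.filter_congr fun j _ ↦ ?_
      simp [rowOf, hG, Fin.ext_iff]
    let x : Equiv.Perm (Fin n) := Equiv.ofFiberEquiv fun i ↦ Fintype.equivOfCardEq (hcard i)
    have hx : ∀ j, G (x j) = F j := fun j ↦ Equiv.ofFiberEquiv_map _ j
    refine ⟨x, fun i j ↦ ?_⟩
    have h1 : rowOf ν (x i) = rowOf ν (x j) ↔ F i = F j := by
      rw [← hx, ← hx]
      simp [rowOf, hG, Fin.ext_iff]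
    rw [h1, hFiff]
    rw [← (hFiff j (F j)).1 rfl]

variable {R : Type u} [CommRing R] (q : Rˣ)

/-- The sum over the parabolic subgroup of a labelling lies in the two-sided ideal generated by
`m_ν` for a partition `ν`. -/
theorem exists_symSum_eq_mul_mElt {f : Fin n → ℕ} (hf : Monotone f) {μ : Composition n}
    (hle : ∀ k, μ.sizeUpTo k ≤ (Finset.univ.filter fun j ↦ f j < k).card)
    (hlt : ∃ k, μ.sizeUpTo k < (Finset.univ.filter fun j ↦ f j < k).card) :
    ∃ ν : Composition n, IsPartition ν ∧ StrictlyDominates ν μ ∧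
      ∃ x y : Hecke R q n, symSum q f = x * mElt q ν * y := by
  obtain ⟨ν, hν, hsize, x, hx⟩ := exists_partition_perm f
  refine ⟨ν, hν, ⟨fun k ↦ (hle k).trans (hsize k), ?_⟩, ?_⟩
  · rintro rfl
    obtain ⟨k, hk⟩ := hlt
    exact (hk.trans_le (hsize k)).false
  -- Correcting `x` inside the blocks of `f` makes it increasing there, so `T_{x v}` intertwines
  -- `m_f` with `m_ν`; it is invertible.
  · obtain ⟨v, hv, hxv⟩ := exists_mul_incrOn hf x
    have h := symSum_mul_T_eq_T_mul_symSum (R := R) q hf (monotone_rowOf ν) hxv fun i j ↦ by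
      rw [Equiv.Perm.mul_apply, Equiv.Perm.mul_apply, ← hx, hv, hv]
    obtain ⟨y, hy⟩ := (isUnit_T (R := R) q (x * v)).exists_right_inv
    refine ⟨T q (x * v), y, ?_⟩
    rw [mElt_eq_symSum, ← h, mul_assoc, hy, mul_one]

end Dominance

/-! ### The generators and the cell ideals -/

section CellIdeal

variable {n : ℕ}

/-- On a block of `g` that `f` does not split, `w` is an increasing bijection of the block to
itself, hence the identity. -/
theorem apply_eq_self_of_incrOn {f g : Fin n → ℕ} {w : Equiv.Perm (Fin n)} (hw : w ∈ stab g)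
    (hincr : IncrOn f w) {i : Fin n} (h : ∀ j, g j = g i → f j = f i) : w i = i := by
  obtain ⟨k, hk⟩ : ∃ k, k = i.1 := ⟨_, rfl⟩
  induction k using Nat.strong_induction_on generalizing i with
  | _ k ih =>
  have hfix : ∀ j, j < i → g j = g i → w j = j := fun j hj hgj ↦
    ih j.1 (hk ▸ hj) (fun l hl ↦ by rw [h l (hl.trans hgj), h j hgj]) rfl
  rcases lt_trichotomy (w i) i with hlt | heq | hgt
  · exact w.injective (hfix _ hlt (hw i))
  · exact heq
  · obtain ⟨j, hj⟩ := w.surjective i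
    have hgj : g j = g i := by rw [← hw j, hj]
    rcases lt_trichotomy j i with hlt | heq | hgt'
    · rw [hfix j hlt hgj] at hj; exact absurd hj hlt.ne
    · rw [heq] at hj; exact hj
    · have := hincr i j hgt' (h j hgj).symm
      rw [hj] at this
      exact absurd this hgt.not_gt

variable {R : Type u} [CommRing R] (q : Rˣ)

/-- The generators of the right ideal lie in the two-sided ideals generated by `m_ν` for
partitions `ν ▷ μ`. -/
theorem exists_mElt_mul_hElt_eq (μ : Composition n) {d : ℕ} (hd : d + 1 < μ.length) {t : ℕ}
    (ht : 1 ≤ t) (ht' : t ≤ μ.blocksFun ⟨d + 1, hd⟩) :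
    ∃ ν : Composition n, IsPartition ν ∧ StrictlyDominates ν μ ∧ ∃ x y : Hecke R q n,
      mElt q μ * hElt q μ ⟨d, Nat.lt_of_succ_lt hd⟩ t = x * mElt q ν * y := by
  classical
  have hs1 := μ.sizeUpTo_succ' ⟨d, Nat.lt_of_succ_lt hd⟩
  have hs2 := μ.sizeUpTo_succ' ⟨d + 1, hd⟩
  simp only at hs1 hs2
  have hs3 := μ.sizeUpTo_le (d + 1 + 1)
  rw [hElt, cosetSum_eq_shuffleSum, mElt_eq_symSum]
  simp only
  have hr1 := fun i ↦ rowOf_lt_iff μ i d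
  have hr2 := fun i ↦ rowOf_lt_iff μ i (d + 1)
  have hr3 := fun i ↦ rowOf_lt_iff μ i (d + 1 + 1)
  set m := μ.sizeUpTo d with hm
  set a := μ.blocksFun ⟨d, Nat.lt_of_succ_lt hd⟩ with ha
  set b := μ.blocksFun ⟨d + 1, hd⟩ with hb
  set s := μ.sizeUpTo (d + 1) with hs
  set f := rowOf μ with hf_def
  have hf : Monotone f := monotone_rowOf μ
  -- Doubling the row labels frees the odd label `2 * d + 1` for the first `t` letters of row `d +
  -- 1`. In `g` these letters join row `d`.
  set f' : Fin n → ℕ := fun i ↦ if s ≤ i.1 ∧ i.1 < s + t then 2 * d + 1 else 2 * f i with hf'_def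
  set g : Fin n → ℕ := fun i ↦ if s ≤ i.1 ∧ i.1 < s + t then d else f i with hg_def
  have hf' : Monotone f' := by
    intro i j hij
    have h1 := hf hij
    have h2 := hr2 i
    have h3 := hr2 j
    rw [Fin.le_def] at hij
    simp only [hf'_def]
    split_ifs <;> omega
  have hg : Monotone g := by
    intro i j hij
    have h1 := hf hij
    have h2 := hr2 i
    have h3 := hr2 j
    rw [Fin.le_def] at hij
    simp only [hg_def]
    split_ifs <;> omega
  have href : ∀ i j, f' i = f' j → f i = f j := by
    intro i j h
    have h2 := hr2 i
    have h3 := hr2 j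
    have h4 := hr3 i
    have h5 := hr3 j
    simp only [hf'_def] at h
    split_ifs at h <;> omega
  have href' : ∀ i j, f' i = f' j → g i = g j := by
    intro i j h
    simp only [hf'_def] at h
    simp only [hg_def]
    split_ifs at h ⊢ <;> omega
  have hsh : (repSum q f' g : Hecke R q n) = shuffleSum q m a t := by
    rw [repSum, shuffleSum]
    refine Finset.sum_congr (Finset.filter_congr fun w _ ↦ ⟨?_, fun h ↦ ⟨fun i ↦ ?_, ?_⟩⟩)
      fun _ _ ↦ rfl
    · rintro ⟨hw, hincr⟩
      refine ⟨fun i hi' ↦ apply_eq_self_of_incrOn hw hincr fun j hj ↦ ?_,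
        fun i j hi' hij hj ↦ hincr i j hij ?_, fun i j hi' hij hj ↦ hincr i j hij ?_⟩
      · have h2 := hr2 i
        have h1 := hr1 i
        simp only [hg_def] at hj
        simp only [hf'_def]
        split_ifs at hj ⊢ <;> omega
      · have h1 := hr1 i
        have h2 := hr2 i
        have h3 := hr1 j
        have h4 := hr2 j
        rw [Fin.lt_def] at hij
        simp only [hf'_def]
        split_ifs <;> omega
      · rw [Fin.lt_def] at hij
        simp only [hf'_def]
        split_ifs <;> omega
    · by_cases hi' : i.1 < m ∨ m + a + t ≤ i.1
      · rw [h.fix i hi']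
      · have h1 := h.le_apply (k := i) (by omega)
        have h2 := h.apply_lt (k := i) (by omega)
        have h3 := hr1 i
        have h4 := hr2 i
        have h5 := hr1 (w i)
        have h6 := hr2 (w i)
        simp only [hg_def]
        split_ifs <;> omega
    · intro i j hij hfij
      by_contra hc
      have hlt : w j < w i := (not_lt.1 hc).lt_of_ne fun e ↦ hij.ne' (w.injective e)
      have h1 := h.mem_of_inversion hij hlt
      simp only [hf'_def] at hfij
      split_ifs at hfij <;> omega
  -- Both `f` and `g` coarsen `f'`. Factoring `m_f` with `m_{f'}` on the right and `m_g` with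
  -- `m_{f'}` on the left turns `m_μ h_{d,t}` into a left multiple of `m_g`.
  have e1 : (symSum q f : Hecke R q n) = anti q (repSum q f' f) * symSum q f' := by
    rw [← anti_symSum q f, symSum_eq_mul_repSum q hf' href, anti_mul, anti_symSum]
  have e2 := symSum_eq_mul_repSum (R := R) q hf' href'
  have hle : ∀ k, Finset.univ.filter (fun j ↦ f j < k) ⊆ Finset.univ.filter fun j ↦ g j < k := by
    intro k j hj
    have h2 := hr2 j
    simp only [Finset.mem_filter, Finset.mem_univ, true_and, hg_def] at hj ⊢
    split_ifs <;> omega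
  obtain ⟨ν, hν, hνμ, x, y, hxy⟩ := exists_symSum_eq_mul_mElt (R := R) q hg (μ := μ)
    (fun k ↦ by rw [← card_rowOf_lt]; exact Finset.card_le_card (hle k))
    -- Dominance is strict at the partial sum over rows `0, …, d`: the first letter `s` of row `d +
    -- 1` has moved up, as `t ≥ 1`.
    ⟨d + 1, by
      rw [← card_rowOf_lt]
      refine Finset.card_lt_card ((Finset.ssubset_iff_of_subset (hle _)).2 ⟨⟨s, by omega⟩, ?_, ?_⟩)
      · simp only [Finset.mem_filter, Finset.mem_univ, true_and, hg_def]
        rw [if_pos (by omega)]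
        omega
      · have := hr2 ⟨s, by omega⟩
        simp only [lt_irrefl, iff_false] at this
        simpa only [Finset.mem_filter, Finset.mem_univ, true_and] using this⟩
  refine ⟨ν, hν, hνμ, anti q (repSum q f' f) * x, y, ?_⟩
  rw [e1, mul_assoc, ← hsh, ← e2, hxy]
  simp only [mul_assoc]

/-- The span of the `m_{𝔰𝔱}` for standard tableaux of shapes `κ ⊵ ν`. -/
noncomputable def weakCellIdeal (ν : Composition n) : Submodule R (Hecke R q n) :=
  Submodule.span R {x | ∃ κ : Composition n, IsPartition κ ∧ Dominates κ ν ∧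
    ∃ s t : Tableau κ, s.IsStandard ∧ t.IsStandard ∧ x = murphy q s t}

theorem weakCellIdeal_mono {κ ν : Composition n} (h : Dominates κ ν) :
    (weakCellIdeal q κ : Submodule R (Hecke R q n)) ≤ weakCellIdeal q ν := by
  refine Submodule.span_mono ?_
  rintro x ⟨l, hl, hlk, hx⟩
  exact ⟨l, hl, hlk.trans h, hx⟩

theorem weakCellIdeal_le_cellIdeal {ν μ : Composition n} (h : StrictlyDominates ν μ) :
    (weakCellIdeal q ν : Submodule R (Hecke R q n)) ≤ cellIdeal q μ := by
  refine Submodule.span_mono ?_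
  rintro x ⟨κ, hκ, hκν, hx⟩
  exact ⟨κ, hκ, ⟨hκν.trans h.1, fun e ↦ h.2 (h.1.antisymm (e ▸ hκν))⟩, hx⟩

theorem anti_mElt (μ : Composition n) : anti q (mElt q μ : Hecke R q n) = mElt q μ := by
  rw [mElt_eq_symSum, anti_symSum]

theorem anti_murphy {μ : Composition n} (s t : Tableau μ) :
    anti q (murphy q s t : Hecke R q n) = murphy q t s := by
  simp only [murphy, anti_mul, anti_anti, anti_mElt, mul_assoc]

theorem anti_mem_weakCellIdeal {ν : Composition n} {x : Hecke R q n}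
    (hx : x ∈ weakCellIdeal q ν) : anti q x ∈ weakCellIdeal q ν := by
  induction hx using Submodule.span_induction with
  | mem y hy =>
    obtain ⟨κ, hκ, hκν, s, t, hs, ht, rfl⟩ := hy
    exact Submodule.subset_span ⟨κ, hκ, hκν, t, s, ht, hs, anti_murphy q s t⟩
  | zero => simp
  | add y z _ _ hy hz => rw [anti_add]; exact add_mem hy hz
  | smul r y _ hy => rw [anti_smul]; exact Submodule.smul_mem _ _ hy

/-- The two-sided ideal generated by `m_ν` is contained in the span of the `m_{𝔰𝔱}` for standard
tableaux of shapes dominating `ν`. -/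
theorem mul_mElt_mul_mem {ν : Composition n} (hν : IsPartition ν) (x y : Hecke R q n) :
    x * mElt q ν * y ∈ weakCellIdeal q ν := by
  induction ν using wellFounded_strictlyDominates.induction generalizing x y with
  | _ ν ih =>
  -- The generators of the ideal factor through `m_κ` with `κ ▷ ν`, where the induction hypothesis
  -- applies.
  have hI : ∀ z ∈ hIdeal (R := R) q ν, ∀ x y, x * z * y ∈ weakCellIdeal q ν := by
    intro z hz
    induction hz using Submodule.span_induction with
    | mem z hz =>
      obtain ⟨d, hd, t, ht, ht', rfl⟩ := hz
      obtain ⟨κ, hκ, hκν, x', y', e⟩ := exists_mElt_mul_hElt_eq (R := R) q ν hd ht ht'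
      intro x y
      rw [e]
      have := weakCellIdeal_mono q hκν.1 (ih κ hκν hκ (x * x') (y' * y))
      simpa only [mul_assoc] using this
    | zero => simp
    | add z z' _ _ hz hz' =>
      intro x y
      rw [mul_add, add_mul]
      exact add_mem (hz x y) (hz' x y)
    | smul r z _ hz =>
      intro x y
      have : x * r • z * y = x * z * (r.unop * y) := by
        rw [← MulOpposite.op_unop r, op_smul_eq_mul, MulOpposite.unop_op]
        simp only [mul_assoc]
      rw [this]
      exact hz _ _
  have hT : ∀ (x : Hecke R q n) (t : Tableau ν), t.IsStandard →
      x * mElt q ν * T q t.perm ∈ weakCellIdeal q ν := by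
    intro x t ht
    -- Straightening works on the right of `m_ν`; the anti-automorphism carries it to the left
    -- factor `x`.
    obtain ⟨z, hz, s, hs, e⟩ := Submodule.mem_sup.1 (mElt_mul_mem q hν (anti q x))
    have e' : x * mElt q ν = anti q z + anti q s := by
      rw [← anti_add, e, anti_mul, anti_anti, anti_mElt]
    rw [e', add_mul]
    refine add_mem ?_ ?_
    · have := anti_mem_weakCellIdeal q (hI z hz (anti q (T q t.perm)) 1)
      simpa only [anti_mul, anti_anti, mul_one, anti_one, one_mul] using this
    · clear e e'
      induction hs using Submodule.span_induction with
      | mem s hs =>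
        obtain ⟨s, hs, rfl⟩ := hs
        rw [anti_mul, anti_mElt]
        exact Submodule.subset_span ⟨ν, hν, fun _ ↦ le_rfl, s, t, hs, ht, rfl⟩
      | zero => simp
      | add y z _ _ hy hz => rw [anti_add, add_mul]; exact add_mem hy hz
      | smul r y _ hy => rw [anti_smul, smul_mul_assoc]; exact Submodule.smul_mem _ _ hy
  obtain ⟨z, hz, s, hs, e⟩ := Submodule.mem_sup.1 (mElt_mul_mem q hν y)
  rw [mul_assoc, ← e, mul_add]
  refine add_mem ?_ ?_
  · simpa only [mul_one] using hI z hz x 1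
  · clear e
    induction hs using Submodule.span_induction with
    | mem s hs =>
      obtain ⟨t, ht, rfl⟩ := hs
      rw [← mul_assoc]
      exact hT x t ht
    | zero => simp
    | add y z _ _ hy hz => rw [mul_add]; exact add_mem hy hz
    | smul r y _ hy => rw [mul_smul_comm]; exact Submodule.smul_mem _ _ hy

theorem mem_cellIdeal_of_mem_hIdeal {μ : Composition n} {z : Hecke R q n}
    (hz : z ∈ hIdeal q μ) : z ∈ cellIdeal q μ := by
  -- `cellIdeal` is defined only as an `R`-span, so a right factor `y` is carried through the
  -- induction.
  suffices h : ∀ y, z * y ∈ cellIdeal q μ by simpa using h 1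
  induction hz using Submodule.span_induction with
  | mem z hz =>
    obtain ⟨d, hd, t, ht, ht', rfl⟩ := hz
    obtain ⟨κ, hκ, hκν, x', y', e⟩ := exists_mElt_mul_hElt_eq (R := R) q μ hd ht ht'
    intro y
    rw [e, mul_assoc]
    exact weakCellIdeal_le_cellIdeal q hκν (mul_mElt_mul_mem q hκ _ _)
  | zero => simp
  | add z z' _ _ hz hz' =>
    intro y
    rw [add_mul]
    exact add_mem (hz y) (hz' y)
  | smul r z _ hz =>
    intro y
    rw [← MulOpposite.op_unop r, op_smul_eq_mul, mul_assoc]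
    exact hz _

end CellIdeal

/-! ### Linear independence modulo the cell ideal -/

section Columns

variable {n : ℕ}

/-- The column of `𝔱^μ` that contains a letter. -/
def colOf (μ : Composition n) (i : Fin n) : ℕ := (μ.invEmbedding i).1

theorem colOf_initialTableau (μ : Composition n) (x : Σ r : Fin μ.length, Fin (μ.blocksFun r)) :
    colOf μ (initialTableau μ x) = x.2.1 := by
  have h1 := initialTableau_val μ x
  have h2 := rowOf_initialTableau μ x
  rw [rowOf] at h2
  rw [colOf, μ.coe_invEmbedding, h2, h1]
  omega

theorem eq_of_rowOf_eq_of_colOf_eq {μ : Composition n} {i j : Fin n} (h : rowOf μ i = rowOf μ j)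
    (h' : colOf μ i = colOf μ j) : i = j := by
  obtain ⟨x, rfl⟩ := (initialTableau μ).surjective i
  obtain ⟨y, rfl⟩ := (initialTableau μ).surjective j
  rw [rowOf_initialTableau, rowOf_initialTableau] at h
  rw [colOf_initialTableau, colOf_initialTableau] at h'
  apply Fin.ext
  rw [initialTableau_val, initialTableau_val, h, h']

theorem colOf_lt (μ : Composition n) (i : Fin n) : colOf μ i < n := by
  have := μ.coe_invEmbedding i
  rw [colOf]
  omega

/-- `w` is the permutation `d(𝔱)` for the tableau `𝔱` with the letters in order down the
columns. -/
def IsColumnReading (μ : Composition n) (w : Equiv.Perm (Fin n)) : Prop :=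
  ∀ i j, w i < w j ↔ colOf μ i < colOf μ j ∨ colOf μ i = colOf μ j ∧ rowOf μ i < rowOf μ j

theorem exists_isColumnReading (μ : Composition n) :
    ∃ w : Equiv.Perm (Fin n), IsColumnReading μ w := by
  set f : Fin n → ℕ ×ₗ ℕ := fun i ↦ toLex (colOf μ i, rowOf μ i) with hf
  have hinj : Function.Injective f := by
    intro i j h
    have h' := toLex.injective h
    rw [Prod.mk.injEq] at h'
    exact eq_of_rowOf_eq_of_colOf_eq h'.2 h'.1
  have hs : StrictMono (f ∘ Tuple.sort f) :=
    (Tuple.monotone_sort f).strictMono_of_injective (hinj.comp (Tuple.sort f).injective)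
  refine ⟨(Tuple.sort f)⁻¹, fun i j ↦ ?_⟩
  rw [← hs.lt_iff_lt]
  simp [hf, Prod.Lex.toLex_lt_toLex]

/-- The labelling of the letters by the columns of the tableau with the letters in order down the
columns. -/
def colLabel (μ : Composition n) (w : Equiv.Perm (Fin n)) (x : Fin n) : ℕ := colOf μ (w⁻¹ x)

variable {μ : Composition n} {w₀ : Equiv.Perm (Fin n)}

theorem monotone_colLabel (h₀ : IsColumnReading μ w₀) : Monotone (colLabel μ w₀) := by
  intro x y hxy
  rcases hxy.eq_or_lt with rfl | hxy
  · exact le_rfl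
  · have := (h₀ (w₀⁻¹ x) (w₀⁻¹ y)).1 (by simpa using hxy)
    rw [colLabel, colLabel]
    omega

/-- `w` maps letters in the same row of `𝔱^κ` to letters with different column labels. -/
def SeparatesRows (κ μ : Composition n) (w₀ w : Equiv.Perm (Fin n)) : Prop :=
  ∀ i j, i ≠ j → rowOf κ i = rowOf κ j → colLabel μ w₀ (w i) ≠ colLabel μ w₀ (w j)

/-- At most one letter per row receives the label `c`, and at most as many letters in all as column
`c` of `μ` is long. The smaller of `k` and that length is exactly what the first `k` rows of `μ`
contain of column `c`. -/
theorem card_le_of_separatesRows (hμ : IsPartition μ) {κ : Composition n}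
    {w : Equiv.Perm (Fin n)} (hw : SeparatesRows κ μ w₀ w) (k c : ℕ) :
    (Finset.univ.filter fun i ↦ rowOf κ i < k ∧ colLabel μ w₀ (w i) = c).card ≤
      (Finset.univ.filter fun j ↦ rowOf μ j < k ∧ colOf μ j = c).card := by
  by_cases h : ∀ j, colOf μ j = c → rowOf μ j < k
  · refine Finset.card_le_card_of_injOn (fun i ↦ w₀⁻¹ (w i)) (fun i hi' ↦ ?_) fun i _ j _ e ↦ ?_
    · simp only [Finset.coe_filter, Finset.mem_univ, true_and, Set.mem_ofPred_eq] at hi' ⊢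
      exact ⟨h _ hi'.2, hi'.2⟩
    · exact w.injective (w₀⁻¹.injective e)
  · push Not at h
    obtain ⟨j, hj, hjk⟩ := h
    refine le_trans (b := (Finset.range k).card) ?_ ?_
    · refine Finset.card_le_card_of_injOn (rowOf κ) (fun i hi' ↦ ?_) fun i hi' j hj e ↦ ?_
      · simp only [Finset.coe_filter, Finset.mem_univ, true_and, Set.mem_ofPred_eq] at hi'
        simpa using hi'.1
      · simp only [Finset.coe_filter, Finset.mem_univ, true_and, Set.mem_ofPred_eq] at hi' hj
        by_contra hne
        exact hw i j hne e (hi'.2.trans hj.2.symm)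
    · obtain ⟨⟨r, c'⟩, rfl⟩ := (initialTableau μ).surjective j
      rw [colOf_initialTableau] at hj
      rw [rowOf_initialTableau] at hjk
      simp only at hj hjk
      have hex : ∀ a ∈ Finset.range k, ∃ b : Fin n, rowOf μ b = a ∧ colOf μ b = c := by
        intro a ha
        rw [Finset.mem_range] at ha
        have hlt : c < μ.blocksFun ⟨a, by omega⟩ := by
          have := hμ (show (⟨a, by omega⟩ : Fin μ.length) ≤ r by rw [Fin.le_def]; simp only; omega)
          omega
        exact ⟨initialTableau μ ⟨⟨a, by omega⟩, ⟨c, hlt⟩⟩, rowOf_initialTableau μ _,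
          colOf_initialTableau μ _⟩
      have : Nonempty (Fin n) := ⟨initialTableau μ ⟨r, c'⟩⟩
      choose! F hF1 hF2 using hex
      refine Finset.card_le_card_of_injOn F (fun a ha ↦ ?_) fun a ha b hb e ↦ ?_
      · simp only [Finset.coe_filter, Finset.mem_univ, true_and, Set.mem_ofPred_eq]
        rw [hF1 a ha, hF2 a ha]
        exact ⟨by simpa using ha, rfl⟩
      · rw [← hF1 a ha, ← hF1 b hb, e]

theorem sum_card_colLabel (κ μ : Composition n) (w₀ w : Equiv.Perm (Fin n)) (k : ℕ) :
    ∑ c ∈ Finset.range n,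
      (Finset.univ.filter fun i ↦ rowOf κ i < k ∧ colLabel μ w₀ (w i) = c).card =
      κ.sizeUpTo k := by
  rw [← card_rowOf_lt, Finset.card_eq_sum_card_fiberwise (f := fun i ↦ colLabel μ w₀ (w i))
    (t := Finset.range n) (fun i _ ↦ by simpa [colLabel] using colOf_lt μ _)]
  simp only [Finset.filter_filter]

theorem sum_card_colOf (μ : Composition n) (k : ℕ) :
    ∑ c ∈ Finset.range n, (Finset.univ.filter fun j ↦ rowOf μ j < k ∧ colOf μ j = c).card =
      μ.sizeUpTo k := by
  simpa [colLabel] using sum_card_colLabel μ μ 1 1 k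

/-- The bound for single columns, summed over all columns. -/
theorem dominates_of_separatesRows (hμ : IsPartition μ) {κ : Composition n}
    {w : Equiv.Perm (Fin n)} (hw : SeparatesRows κ μ w₀ w) : Dominates μ κ := by
  intro k
  rw [← sum_card_colLabel κ μ w₀ w, ← sum_card_colOf μ]
  exact Finset.sum_le_sum fun c _ ↦ card_le_of_separatesRows hμ hw k c

theorem card_filter_lt_succ (p : Fin n → ℕ) (s : Fin n → Prop) [DecidablePred s] (r : ℕ) :
    (Finset.univ.filter fun i ↦ p i < r + 1 ∧ s i).card =
      (Finset.univ.filter fun i ↦ p i < r ∧ s i).card +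
        (Finset.univ.filter fun i ↦ p i = r ∧ s i).card := by
  rw [← Finset.card_union_of_disjoint]
  · congr 1
    ext i
    simp only [Finset.mem_filter, Finset.mem_univ, true_and, Finset.mem_union]
    constructor
    · rintro ⟨h, h'⟩
      rcases Nat.lt_succ_iff_lt_or_eq.1 h with h | h
      · exact Or.inl ⟨h, h'⟩
      · exact Or.inr ⟨h, h'⟩
    · rintro (⟨h, h'⟩ | ⟨h, h'⟩) <;> exact ⟨by omega, h'⟩
  · rw [Finset.disjoint_filter]
    rintro i _ ⟨h, -⟩ ⟨h', -⟩
    omega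

/-- For `κ = μ` the column bounds add up to equal totals, so each is an equality. Hence the labels
in row `r` are distinct and below `μ_r`; as they increase along the row, they are the column
numbers. -/
theorem colLabel_apply_eq_colOf (hμ : IsPartition μ) (h₀ : IsColumnReading μ w₀)
    {w : Equiv.Perm (Fin n)} (hw : SeparatesRows μ μ w₀ w) (hrow : IncrOn (rowOf μ) w)
    (i : Fin n) : colLabel μ w₀ (w i) = colOf μ i := by
  have heq : ∀ k, ∀ c ∈ Finset.range n,
      (Finset.univ.filter fun i ↦ rowOf μ i < k ∧ colLabel μ w₀ (w i) = c).card =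
        (Finset.univ.filter fun j ↦ rowOf μ j < k ∧ colOf μ j = c).card := fun k ↦
    (Finset.sum_eq_sum_iff_of_le fun c _ ↦ card_le_of_separatesRows hμ hw k c).1
      ((sum_card_colLabel μ μ w₀ w k).trans (sum_card_colOf μ k).symm)
  have hbound : ∀ (r : Fin μ.length) (c : Fin (μ.blocksFun r)),
      colLabel μ w₀ (w (initialTableau μ ⟨r, c⟩)) < μ.blocksFun r := by
    intro r c
    set i := initialTableau μ ⟨r, c⟩ with hi_def
    have hi' : rowOf μ i = r := rowOf_initialTableau μ ⟨r, c⟩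
    have hc : colLabel μ w₀ (w i) ∈ Finset.range n := by simpa [colLabel] using colOf_lt μ _
    have h1 := heq (r + 1) _ hc
    rw [card_filter_lt_succ, card_filter_lt_succ, heq r _ hc, Nat.add_left_cancel_iff] at h1
    have h2 : 0 < (Finset.univ.filter fun j ↦
        rowOf μ j = r ∧ colOf μ j = colLabel μ w₀ (w i)).card := by
      rw [← h1]
      exact Finset.card_pos.2 ⟨i, by simp [hi']⟩
    obtain ⟨j, hj⟩ := Finset.card_pos.1 h2
    simp only [Finset.mem_filter, Finset.mem_univ, true_and] at hj
    obtain ⟨⟨r', c'⟩, rfl⟩ := (initialTableau μ).surjective j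
    rw [rowOf_initialTableau, colOf_initialTableau] at hj
    obtain rfl : r' = r := Fin.ext hj.1
    rw [← hj.2]
    exact c'.2
  obtain ⟨⟨r, c⟩, rfl⟩ := (initialTableau μ).surjective i
  let ψ : Fin (μ.blocksFun r) → Fin (μ.blocksFun r) := fun c ↦ ⟨_, hbound r c⟩
  have hψ : StrictMono ψ := by
    intro a b hab
    have hlt : initialTableau μ ⟨r, a⟩ < initialTableau μ ⟨r, b⟩ := by
      rw [Fin.lt_def, initialTableau_val, initialTableau_val]
      simpa using hab
    have hr : rowOf μ (initialTableau μ ⟨r, a⟩) = rowOf μ (initialTableau μ ⟨r, b⟩) := by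
      rw [rowOf_initialTableau, rowOf_initialTableau]
    exact lt_of_le_of_ne (monotone_colLabel h₀ (hrow _ _ hlt hr).le) fun e ↦
      hw _ _ hlt.ne hr (congrArg Fin.val e)
  have h1 : Equiv.ofBijective ψ (Finite.injective_iff_bijective.1 hψ.injective) = 1 :=
    (Equiv.Perm.monotone_iff _).1 hψ.monotone
  have h2 := congrArg Fin.val (Equiv.congr_fun h1 c)
  rw [colOf_initialTableau]
  exact h2

/-- Both `w` and `w₀` send each letter to the label of its column, and both order the letters of one
column from top to bottom. -/
theorem eq_of_separatesRows (hμ : IsPartition μ) (h₀ : IsColumnReading μ w₀)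
    {w : Equiv.Perm (Fin n)} (hw : SeparatesRows μ μ w₀ w) (hrow : IncrOn (rowOf μ) w)
    (hcol : IncrOn (colLabel μ w₀) w⁻¹) : w = w₀ := by
  have hlab := colLabel_apply_eq_colOf hμ h₀ hw hrow
  have hstab : ∀ x, colLabel μ w₀ ((w₀ * w⁻¹) x) = colLabel μ w₀ x := by
    intro x
    have := hlab (w⁻¹ x)
    simp only [Equiv.Perm.inv_def, Equiv.apply_symm_apply] at this
    rw [this]
    simp [colLabel]
  have h1 : w₀ * w⁻¹ = 1 := by
    refine eq_one_of_lt fun x y hxy ↦ ?_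
    rcases (monotone_colLabel h₀ hxy.le).eq_or_lt with e | hlt
    · have h2 := hcol x y hxy e
      have h3 : colOf μ (w⁻¹ x) = colOf μ (w⁻¹ y) := by
        rw [← hlab, ← hlab]
        simpa using e
      refine (h₀ _ _).2 (Or.inr ⟨h3, lt_of_le_of_ne (monotone_rowOf μ h2.le) fun e ↦ ?_⟩)
      exact h2.ne (eq_of_rowOf_eq_of_colOf_eq e h3)
    · by_contra hc
      have := monotone_colLabel h₀ (not_lt.1 hc)
      rw [hstab, hstab] at this
      omega
  exact (mul_inv_eq_one.1 h1).symm

/-- Removing a descent inside a row or inside a column label shortens `w` and keeps rows separated;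
the only place to stop is `w₀`. -/
theorem eq_or_length_lt_of_separatesRows (hμ : IsPartition μ) (h₀ : IsColumnReading μ w₀)
    {w : Equiv.Perm (Fin n)} (hw : SeparatesRows μ μ w₀ w) : w = w₀ ∨ length w₀ < length w := by
  induction hk : length w using Nat.strong_induction_on generalizing w with
  | _ k ih =>
  by_cases h1 : ∃ i : Fin (n - 1), rowOf μ (lo i) = rowOf μ (hi i) ∧ w (hi i) < w (lo i)
  · obtain ⟨i, hfi, hwi⟩ := h1
    have hl := length_mul_simple_of_gt hwi
    right
    rcases ih _ (by omega) (w := w * simple i) (fun a b hab hr ↦ hw _ _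
      (fun e ↦ hab ((simple i).injective e)) (by
        rw [simple_mem_stab hfi, simple_mem_stab hfi, hr])) rfl with h | h
    · rw [h] at hl; omega
    · omega
  by_cases h2 : ∃ i : Fin (n - 1), colLabel μ w₀ (lo i) = colLabel μ w₀ (hi i) ∧
      w⁻¹ (hi i) < w⁻¹ (lo i)
  · obtain ⟨i, hgi, hwi⟩ := h2
    have hl := length_simple_mul_of_gt hwi
    right
    rcases ih _ (by omega) (w := simple i * w) (fun a b hab hr ↦ by
      rw [Equiv.Perm.mul_apply, Equiv.Perm.mul_apply, simple_mem_stab hgi, simple_mem_stab hgi]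
      exact hw a b hab hr) rfl with h | h
    · rw [h] at hl; omega
    · omega
  push Not at h1 h2
  exact Or.inl (eq_of_separatesRows hμ h₀ hw
    (incrOn_of_forall_lo_lt_hi (monotone_rowOf μ) fun i h ↦ (h1 i h).not_gt)
    (incrOn_of_forall_lo_lt_hi (monotone_colLabel h₀) fun i h ↦ (h2 i h).not_gt))

/-- The hypotheses place `j` weakly below and weakly to the right of `i`, so standardness orders the
entries via the node in the row of `i` and the column of `j`. Consequently `d(𝔱)` inverts only pairs
that `w₀` inverts, which makes it an initial factor of `w₀`. -/
theorem Tableau.IsStandard.perm_lt (hμ : IsPartition μ) (h₀ : IsColumnReading μ w₀)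
    {t : Tableau μ} (ht : t.IsStandard) {i j : Fin n} (hij : i < j) (hw : w₀ i < w₀ j) :
    t.perm i < t.perm j := by
  have hr := monotone_rowOf μ hij.le
  have hc := (h₀ i j).1 hw
  obtain ⟨⟨r, c⟩, rfl⟩ := (initialTableau μ).surjective i
  obtain ⟨⟨r', c'⟩, rfl⟩ := (initialTableau μ).surjective j
  rw [rowOf_initialTableau, rowOf_initialTableau] at hr hc
  rw [colOf_initialTableau, colOf_initialTableau] at hc
  simp only [Tableau.perm, Equiv.trans_apply, Equiv.symm_apply_apply]
  simp only at hr hc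
  rcases hr.eq_or_lt with e | hlt
  · obtain rfl : r = r' := Fin.ext e
    exact ht.1 r c c' (by rw [Fin.lt_def]; omega)
  · have hc' : c'.1 < μ.blocksFun r := c'.2.trans_le (hμ (by rw [Fin.le_def]; omega))
    refine lt_of_le_of_lt (b := t ⟨r, ⟨c'.1, hc'⟩⟩) ?_ (ht.2 r r' _ c' hlt rfl)
    rcases (show c.1 ≤ c'.1 by omega).eq_or_lt with e | hlt'
    · rw [show c = ⟨c'.1, hc'⟩ from Fin.ext e]
    · exact (ht.1 r c ⟨c'.1, hc'⟩ hlt').le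

/-! ### Multiplication by the signed column sum. -/

variable {R : Type u} [CommRing R] (q : Rˣ)

/-- A `w` that separated the rows of `ν` would give `μ ⊵ ν`; so every `w` puts two letters of a row
into one column. -/
theorem mElt_mul_altSum_eq_zero (hμ : IsPartition μ) (h₀ : IsColumnReading μ w₀)
    {ν : Composition n} (hν : StrictlyDominates ν μ) (x : Hecke R q n) :
    mElt q ν * x * altSum q (colLabel μ w₀) = 0 := by
  induction x using T_induction_span with
  | T_mem w =>
    have h : ¬ SeparatesRows ν μ w₀ w := fun h ↦
      hν.2 (hν.1.antisymm (dominates_of_separatesRows hμ h))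
    simp only [SeparatesRows] at h
    push Not at h
    obtain ⟨i, j, hij, hr, hc⟩ := h
    rw [mElt_eq_symSum]
    exact symSum_mul_T_mul_altSum_eq_zero q (monotone_rowOf ν) (monotone_colLabel h₀) w hij hr hc
  | zero => simp
  | add x y hx hy => rw [mul_add, add_mul, hx, hy, add_zero]
  | smul r x hx => rw [mul_smul_comm, smul_mul_assoc, hx, smul_zero]

theorem mul_altSum_eq_zero_of_mem_cellIdeal (hμ : IsPartition μ) (h₀ : IsColumnReading μ w₀)
    {x : Hecke R q n} (hx : x ∈ cellIdeal q μ) (y : Hecke R q n) :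
    x * y * altSum q (colLabel μ w₀) = 0 := by
  induction hx using Submodule.span_induction with
  | mem x hx =>
    obtain ⟨ν, -, hν, s, t, -, -, rfl⟩ := hx
    have := mElt_mul_altSum_eq_zero q hμ h₀ hν (T q t.perm * y)
    rw [murphy, mul_assoc (anti q _), mul_assoc (anti q _), mul_assoc (anti q _),
      mul_assoc (mElt q ν), this, mul_zero]
  | zero => simp
  | add x z _ _ hx hz => rw [add_mul, add_mul, hx, hz, add_zero]
  | smul r x _ hx => rw [smul_mul_assoc, smul_mul_assoc, hx, smul_zero]

theorem mElt_mul_T_mul_altSum_eq_zero (hμ : IsPartition μ) (h₀ : IsColumnReading μ w₀)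
    {w : Equiv.Perm (Fin n)} (hw : w ≠ w₀) (hl : length w ≤ length w₀) :
    (mElt q μ * T q w * altSum q (colLabel μ w₀) : Hecke R q n) = 0 := by
  have h : ¬ SeparatesRows μ μ w₀ w := fun h ↦ by
    rcases eq_or_length_lt_of_separatesRows hμ h₀ h with h | h
    · exact hw h
    · omega
  simp only [SeparatesRows] at h
  push Not at h
  obtain ⟨i, j, hij, hr, hc⟩ := h
  rw [mElt_eq_symSum]
  exact symSum_mul_T_mul_altSum_eq_zero q (monotone_rowOf μ) (monotone_colLabel h₀) w hij hr hc

/-- Every `T_u T_{w₀} T_v` in the expansion is a single basis element, and it is `T_{w₀}` only for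
`u = v = 1`, because a permutation that preserves both rows and columns is trivial. -/
theorem coeff_mElt_mul_T_mul_altSum (h₀ : IsColumnReading μ w₀) :
    coeff q w₀ (mElt q μ * T q w₀ * altSum q (colLabel μ w₀) : Hecke R q n) = 1 := by
  classical
  have hrow : IncrOn (rowOf μ) w₀ := by
    intro i j hij hr
    rw [h₀]
    obtain ⟨⟨r, c⟩, rfl⟩ := (initialTableau μ).surjective i
    obtain ⟨⟨r', c'⟩, rfl⟩ := (initialTableau μ).surjective j
    rw [rowOf_initialTableau, rowOf_initialTableau] at hr
    obtain rfl : r = r' := Fin.ext hr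
    rw [Fin.lt_def, initialTableau_val, initialTableau_val] at hij
    rw [colOf_initialTableau, colOf_initialTableau]
    simp only at hij ⊢
    omega
  have key : ∀ u ∈ stab (rowOf μ), ∀ v ∈ stab (colLabel μ w₀),
      (T q u * T q w₀ * T q v : Hecke R q n) = T q (v * (w₀ * u)) := by
    intro u hu v hv
    rw [T_mul_T_of_incrOn q (monotone_rowOf μ) hu hrow]
    refine T_mul_T q fun i j hij hlt ↦ ?_
    by_contra hc
    have hlt' : v ((w₀ * u) i) < v ((w₀ * u) j) := (not_lt.1 hc).lt_of_ne fun e ↦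
      hij.ne ((w₀ * u).injective (v.injective e))
    have h1 := monotone_colLabel h₀ hlt'.le
    have h2 := monotone_colLabel h₀ hlt.le
    rw [hv, hv] at h1
    simp only [colLabel, Equiv.Perm.mul_apply, Equiv.Perm.inv_def, Equiv.symm_apply_apply] at h1 h2
    have h3 := (h₀ _ _).1 hlt
    have h4 := monotone_rowOf μ hij.le
    have h5 := hu i
    have h6 := hu j
    omega
  have huv : ∀ u ∈ stab (rowOf μ), ∀ v ∈ stab (colLabel μ w₀), v * (w₀ * u) = w₀ →
      u = 1 ∧ v = 1 := by
    intro u hu v hv e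
    have hu1 : u = 1 := by
      ext1 i
      refine eq_of_rowOf_eq_of_colOf_eq (hu i) ?_
      have h1 := hv (w₀ (u i))
      have h2 : v (w₀ (u i)) = w₀ i := Equiv.congr_fun e i
      rw [h2] at h1
      simpa [colLabel] using h1.symm
    subst hu1
    exact ⟨rfl, by simpa using e⟩
  rw [mElt_eq_symSum, symSum, altSum, Finset.sum_mul, Finset.sum_mul_sum, map_sum,
    Finset.sum_eq_single 1]
  · rw [map_sum, Finset.sum_eq_single 1]
    · simp [coeff_T]
    · intro v hv hv1
      simp only [Finset.mem_filter, Finset.mem_univ, true_and] at hv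
      rw [mul_smul_comm, key 1 (one_mem _) v hv, map_smul, coeff_T, if_neg, smul_zero]
      exact fun e ↦ hv1 (huv 1 (one_mem _) v hv e).2
    · intro h
      exact absurd (by simp [one_mem]) h
  · intro u hu hu1
    simp only [Finset.mem_filter, Finset.mem_univ, true_and] at hu
    rw [map_sum]
    refine Finset.sum_eq_zero fun v hv ↦ ?_
    simp only [Finset.mem_filter, Finset.mem_univ, true_and] at hv
    rw [mul_smul_comm, key u hu v hv, map_smul, coeff_T, if_neg, smul_zero]
    exact fun e ↦ hu1 (huv u hu v hv e).1
  · intro h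
    exact absurd (by simp [one_mem]) h

/-- The elements `m_μ T_{d(𝔱)}` for standard tableaux `𝔱` are linearly independent modulo
`ℋ^{▷μ}`. -/
theorem eq_zero_of_mem_standardSpan_of_mem_cellIdeal (hμ : IsPartition μ) {x : Hecke R q n}
    (hx : x ∈ standardSpan q μ) (hx' : x ∈ cellIdeal q μ) : x = 0 := by
  classical
  obtain ⟨w₀, h₀⟩ := exists_isColumnReading μ
  have hrange : {x : Hecke R q n | ∃ t : Tableau μ, t.IsStandard ∧ x = mElt q μ * T q t.perm} =
      Set.range fun t : {t : Tableau μ // t.IsStandard} ↦ mElt q μ * T q t.1.perm := by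
    ext y
    constructor
    · rintro ⟨t, ht, rfl⟩; exact ⟨⟨t, ht⟩, rfl⟩
    · rintro ⟨⟨t, ht⟩, rfl⟩; exact ⟨t, ht, rfl⟩
  rw [standardSpan, hrange, Submodule.mem_span_range_iff_exists_fun] at hx
  obtain ⟨a, ha⟩ := hx
  suffices h : ∀ t, a t = 0 by rw [← ha]; simp [h]
  by_contra! hne
  -- Choose `t` with `d(t)` longest among the nonzero coefficients, and multiply by the `T_v` with
  -- `T_{d(t)} T_v = T_{w₀}`, then by the signed sum.
  obtain ⟨t, ht, hmax⟩ := Finset.exists_max_image (Finset.univ.filter fun t ↦ a t ≠ 0)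
    (fun t ↦ length t.1.perm) (by obtain ⟨t, ht⟩ := hne; exact ⟨t, by simpa using ht⟩)
  simp only [Finset.mem_filter, Finset.mem_univ, true_and] at ht hmax
  have hadd : ∀ i j, i < j → t.1.perm j < t.1.perm i →
      (w₀ * t.1.perm⁻¹) (t.1.perm j) < (w₀ * t.1.perm⁻¹) (t.1.perm i) := by
    intro i j hij hlt
    simp only [Equiv.Perm.mul_apply, Equiv.Perm.inv_def, Equiv.symm_apply_apply]
    by_contra hc
    exact hlt.not_gt (t.2.perm_lt hμ h₀ hij
      ((not_lt.1 hc).lt_of_ne fun e ↦ hij.ne (w₀.injective e)))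
  have hT := T_mul_T (R := R) q hadd
  have hlen := length_mul_of_forall hadd
  rw [inv_mul_cancel_right] at hT hlen
  have hzero := mul_altSum_eq_zero_of_mem_cellIdeal q hμ h₀ hx' (T q (w₀ * t.1.perm⁻¹))
  rw [← ha, Finset.sum_mul, Finset.sum_mul, Finset.sum_eq_single t] at hzero
  · rw [smul_mul_assoc, smul_mul_assoc, mul_assoc (mElt q μ), hT] at hzero
    have := congrArg (coeff q w₀) hzero
    rw [map_smul, coeff_mElt_mul_T_mul_altSum q h₀, map_zero, smul_eq_mul, mul_one] at this
    exact ht this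
  · intro s _ hst
    by_cases has : a s = 0
    · simp [has]
    have hle := hmax s has
    rw [smul_mul_assoc, smul_mul_assoc, mul_assoc (mElt q μ)]
    -- By maximality `ℓ(d(s)) + ℓ(v) ≤ ℓ(w₀)`, so for `s ≠ t` only elements different from `w₀` and
    -- not longer than it occur; the signed sum kills them all.
    have hmem := T_mul_T_mem_span (R := R) q s.1.perm (w₀ * t.1.perm⁻¹)
    suffices h : mElt q μ * (T q s.1.perm * T q (w₀ * t.1.perm⁻¹)) *
        altSum q (colLabel μ w₀) = 0 by rw [h, smul_zero]
    generalize (T q s.1.perm * T q (w₀ * t.1.perm⁻¹) : Hecke R q n) = y at hmem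
    induction hmem using Submodule.span_induction with
    | mem y hy =>
      obtain ⟨w, hw, rfl⟩ := hy
      have hsmall : length w < length w₀ → w ≠ w₀ ∧ length w ≤ length w₀ := fun h ↦
        ⟨fun e ↦ by rw [e] at h; exact h.false, h.le⟩
      have hprod : length (w₀ * t.1.perm⁻¹ * s.1.perm) ≤
          length s.1.perm + length (w₀ * t.1.perm⁻¹) := length_mul_le _ _
      obtain ⟨h1, h2⟩ : w ≠ w₀ ∧ length w ≤ length w₀ := by
        rcases hw with rfl | hw
        · refine ⟨fun e ↦ hst ?_, by omega⟩
          rw [mul_assoc, mul_eq_left, inv_mul_eq_one] at e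
          have e' : s.1 = t.1 := by
            have := congrArg (fun p : Equiv.Perm (Fin n) ↦ (initialTableau μ).trans p) e
            ext1 x
            simpa [Tableau.perm] using (Equiv.congr_fun this x).symm
          exact Subtype.ext e'
        · exact hsmall (by omega)
      exact mElt_mul_T_mul_altSum_eq_zero q hμ h₀ h1 h2
    | zero => simp
    | add y z _ _ hy hz => rw [mul_add, add_mul, hy, hz, add_zero]
    | smul r y _ hy => rw [mul_smul_comm, smul_mul_assoc, hy, smul_zero]
  · simp

end Columns

end HeckeTypeA

/-! ### The two inclusions. -/

theorem mainTheorem1 {R : Type*} [CommRing R] (q : Rˣ) (n : ℕ) (μ : Composition n)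
    (hμ : HeckeTypeA.IsPartition μ) :
    (HeckeTypeA.hIdeal q μ : Set (HeckeTypeA.Hecke R q n)) =
      (HeckeTypeA.permModule q μ : Set (HeckeTypeA.Hecke R q n)) ∩
        (HeckeTypeA.cellIdeal q μ : Set (HeckeTypeA.Hecke R q n)) := by
  open HeckeTypeA in
  apply Set.Subset.antisymm
  · intro x hx
    refine ⟨?_, mem_cellIdeal_of_mem_hIdeal q hx⟩
    refine (Submodule.span_le (p := permModule q μ)).2 ?_ hx
    rintro y ⟨d, hd, t, -, -, rfl⟩
    exact (permModule q μ).smul_mem (MulOpposite.op (hElt q μ ⟨d, Nat.lt_of_succ_lt hd⟩ t))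
      (Submodule.subset_span rfl)
  · rintro x ⟨hx, hx'⟩
    obtain ⟨h, rfl⟩ := Submodule.mem_span_singleton.1 hx
    obtain ⟨z, hz, s, hs, e⟩ := Submodule.mem_sup.1 (mElt_mul_mem q hμ h.unop)
    have e' : h • mElt q μ = z + s := e.symm
    -- The standard part `s` is the difference of two elements of `cellIdeal`, so independence
    -- modulo that span forces it to vanish.
    have hs' : s ∈ cellIdeal q μ := by
      have : s = h • mElt q μ - z := by rw [e']; abel
      rw [this]
      exact Submodule.sub_mem _ hx' (mem_cellIdeal_of_mem_hIdeal q hz)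
    rw [eq_zero_of_mem_standardSpan_of_mem_cellIdeal q hμ hs hs', add_zero] at e'
    rw [e']
    exact hz
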